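/- **Setting.** Let $n$ agents choose $x_1,\dots,x_n\in\mathbb R^m$, $x=(x_1,\dots,x_n)$. For rationality parameters $\theta\in\mathbb R^p$ and context parameters $\mu\in\mathbb R^q$, agent $i$ minimizes a cost $u_i(x_i;x_{-i},\theta,\mu)$ over $x_i$ subject to $B_i(\theta,\mu)x_i+D_i(\theta,\mu)x_{-i}\le b_i(\theta,\mu)$ ($l$ inequalities). Write all these constraints together as $A(\theta,\mu)x\le b(\theta,\mu)$; a row index of $A$ is called a constraint. Let $\mathcal D=\{(\bar x^k,\bar\mu^k)\}_{k=1}^K$ be the data and let $\Theta\subseteq\mathbb R^p$ be open and convex (for example $\Theta=\mathbb R^p$). For every $\theta\in\Theta$ and every $k$ assume that $\{x: Ax\le b\}$ is nonempty at $(\theta,\bar\mu^k)$ and that the game is a potential game with convex quadratic potential: there are a symmetric positive semidefinite matrix $R(\theta,\bar\mu^k)$ and a vector $c(\theta,\bar\mu^k)$ such that $x$ is a (generalized) Nash equilibrium if and only if it minimizes $\Phi(x)=\tfrac12x^TRx+c^Tx$ over $\{x: Ax\le b\}$. The entries of $R,c,A,b$ at $\bar\mu^k$ are continuously differentiable in $\theta\in\Theta$.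 For $\theta\in\Theta$ let $x^k(\theta)$ be the Nash equilibrium at $(\theta,\bar\mu^k)$, let $\lambda^k(\theta)\ge 0$ be its dual variables (so that $Rx^k+c+A^T\lambda^k=0$ and $(b-Ax^k)^T\lambda^k=0$), and let $Z_k(\theta)=\{z: b_z-(Ax^k(\theta))_z=0\}$ and $Y_k(\theta)=\{z:\lambda^k_z(\theta)=0\}$. For a set $Z$ of constraints with complement $Y$ let $$S_k(Z,\theta)=\begin{bmatrix}R&A^T\\-A_Z&0\\0&I_Y\end{bmatrix}$$ at $(\theta,\bar\mu^k)$, and let $x^k_Z(\theta)$ be the $x$-component of the solution of $Rx+c+A^T\lambda=0$, $b_Z-A_Zx=0$, $\lambda_Y=0$. Let $\nabla\mathcal L(\theta;\{\bar x^k\})$ denote the gradient at $\theta$ of $\vartheta\mapsto\|x^k_Z(\vartheta)-\bar x^k\|_2^2$ for the fixed set $Z=Z_k(\theta)$. **Constraint qualifications.** (1) For all $\theta\in\Theta$ and $k$, at every point of $\{x:Ax\le b\}$ the rows of $A$ that are tight there are linearly independent. (2) The sets $\{x: A(\theta,\bar\mu^k)x\le b(\theta,\bar\mu^k)\}$, $\theta\in\Theta$,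 $k\le K$, are uniformly bounded. **Well-behaved derivatives.** (1) There is $L_0>0$ such that, for all $\theta\in\Theta$, all $k$ and every active set $Z$ (the set of tight constraints of some point of $\{x:Ax\le b\}$), $S_k(Z,\theta)$ is invertible and $\|S_k(Z,\theta)^{-T}\|_\infty<L_0$. (2) For almost every $\theta\in\Theta$, $Z_k(\theta)\cap Y_k(\theta)=\emptyset$ for all $k$. (3) There is $L_3>0$ with $\|\partial_{\theta_j}R(\theta,\bar\mu^k)\|_\infty\le L_3$ for all $\theta\in\Theta$, $k$, $j$; likewise $\partial_{\theta_j}c$, $\partial_{\theta_j}b$, $\partial_{\theta_j}A$ and $(\partial_{\theta_j}A)^T\lambda^k(\theta)$ are bounded over $\theta\in\Theta$, $k$, $j$ (the last two conditions are void if $A$ does not depend on $\theta$). **Algorithm.** Fix $\varepsilon>0$, $\theta_0\in\mathbb R^p$ and step sizes $\eta_t>0$. Start at $\theta^{(0)}=\theta_0$. At every step $t=0,1,2,\dots$ draw $k_t$ uniformly from $\{1,\dots,K\}$ and $\tilde\theta_t$ uniformly from the Euclidean ball $B_\varepsilon(\theta^{(t)})$, that is, $\tilde\theta_t=\theta^{(t)}+U_t$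 with $U_t$ uniform on $B_\varepsilon(0)$, all draws $k_t,U_t$ being independent, and set $$\theta^{(t+1)}=\theta^{(t)}-\eta_t\nabla\mathcal L(\tilde\theta_t;\{\bar x^{k_t}\}).$$ Assume that, almost surely, the closed balls $\overline{B_\varepsilon(\theta^{(t)})}$, $t\ge0$, lie in $\Theta$ (no condition if $\Theta=\mathbb R^p$). Let $$G(v)=\frac1K\sum_{k=1}^K\frac1{|B_\varepsilon(v)|}\int_{B_\varepsilon(v)}\nabla\mathcal L(u;\{\bar x^k\})\,du,\qquad g(\theta)=\int_0^1\langle G(\theta_0+s(\theta-\theta_0)),\theta-\theta_0\rangle\,ds,$$ where $|\cdot|$ is Lebesgue measure; $g$ is the $\varepsilon$-smoothed loss. **Theorem.** For every $\theta\in\Theta$ and $k$ the Nash equilibrium $x^k(\theta)$ is unique; for almost every $\theta\in\Theta$ and all $k$, $\nabla\mathcal L(\theta;\{\bar x^k\})$ is the gradient at $\theta$ of $\|x^k(\cdot)-\bar x^k\|_2^2$; and at every $\theta$ with $\overline{B_\varepsilon(\theta)}\subseteq\Theta$ each $\nabla\mathcal L(\cdot;\{\bar x^k\})$ is integrable over $B_\varepsilon(\theta)$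 and $g$ is differentiable with $\nabla g(\theta)=G(\theta)$. If the step sizes satisfy $\sum_t\eta_t=\infty$ and $\sum_t\eta_t^2<\infty$, then $\|\nabla g(\theta^{(T)})\|_2$ is integrable for every $T$ and $$\lim_{T\to\infty}\mathbb E\big[\|\nabla g(\theta^{(T)})\|_2\big]=0 .$$ -/

import Mathlib

open MeasureTheory Set
open scoped Matrix

noncomputable section

namespace InverseGame

/-- Rationality parameters, with the Euclidean norm. -/
abbrev Param (p : ℕ) := EuclideanSpace ℝ (Fin p)

/-- Strategy profiles of `n` agents with `m` variables each; `x (i, s)` is variable `s` of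
agent `i`. -/
abbrev Profile (n m : ℕ) := Fin n × Fin m → ℝ

/-- One entry for each of the `l` constraints of each of the `n` agents. -/
abbrev Dual (n l : ℕ) := Fin n × Fin l → ℝ

/-- The infinity norm of a matrix (the operator norm for the sup norms): the largest absolute
row sum. -/
def infNorm {ι κ : Type*} [Fintype κ] (M : Matrix ι κ ℝ) : ℝ :=
  ⨆ i, ∑ j, |M i j|

/-- The `j`-th partial derivative of a real function of the rationality parameters. -/
def pderiv {p : ℕ} (j : Fin p) (f : Param p → ℝ) (θ : Param p) : ℝ :=
  fderiv ℝ f θ (EuclideanSpace.single j 1)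

/-- A parametrized mathematical programming game together with the coefficients `R`, `c` of a
quadratic function of the strategy profile.  Given rationality parameters `θ` and context
parameters `μ`, agent `i` minimizes `cost i θ μ` over its own variables `x_i` subject to
`B i θ μ x_i + D i θ μ x_{-i} ≤ b i θ μ`. -/
structure Game (n m l p q : ℕ) where
  cost : Fin n → Param p → (Fin q → ℝ) → Profile n m → ℝ
  B : Fin n → Param p → (Fin q → ℝ) → Matrix (Fin l) (Fin m) ℝ
  D : (i : Fin n) → Param p → (Fin q → ℝ) → Matrix (Fin l) ({j : Fin n // j ≠ i} × Fin m) ℝ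
  b : Fin n → Param p → (Fin q → ℝ) → Fin l → ℝ
  R : Param p → (Fin q → ℝ) → Matrix (Fin n × Fin m) (Fin n × Fin m) ℝ
  c : Param p → (Fin q → ℝ) → Profile n m

/-- The variables of agent `i`. -/
def own {n m : ℕ} (i : Fin n) (x : Profile n m) : Fin m → ℝ := fun s => x (i, s)

/-- The variables of the agents other than `i`. -/
def others {n m : ℕ} (i : Fin n) (x : Profile n m) : {j : Fin n // j ≠ i} × Fin m → ℝ :=
  fun js => x (js.1, js.2)

/-- The profile in which agent `i` plays `y` and the other agents play as in `x`. -/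
def deviate {n m : ℕ} (i : Fin n) (x : Profile n m) (y : Fin m → ℝ) : Profile n m :=
  fun js => if js.1 = i then y js.2 else x js

namespace Game

variable {n m l p q : ℕ} (G : Game n m l p q)

/-- The constraints of agent `i`. -/
def AgentFeasible (i : Fin n) (θ : Param p) (μ : Fin q → ℝ) (x : Profile n m) : Prop :=
  G.B i θ μ *ᵥ own i x + G.D i θ μ *ᵥ others i x ≤ G.b i θ μ

/-- (Generalized) Nash equilibria. -/
def IsNash (θ : Param p) (μ : Fin q → ℝ) (x : Profile n m) : Prop :=
  ∀ i, G.AgentFeasible i θ μ x ∧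
    ∀ y : Fin m → ℝ, G.AgentFeasible i θ μ (deviate i x y) →
      G.cost i θ μ x ≤ G.cost i θ μ (deviate i x y)

/-- The matrix of all constraints of all agents. -/
def A (θ : Param p) (μ : Fin q → ℝ) : Matrix (Fin n × Fin l) (Fin n × Fin m) ℝ :=
  Matrix.of fun z w =>
    if h : w.1 = z.1 then G.B z.1 θ μ z.2 w.2 else G.D z.1 θ μ z.2 (⟨w.1, h⟩, w.2)

/-- The right-hand side of all constraints of all agents. -/
def rhs (θ : Param p) (μ : Fin q → ℝ) : Dual n l := fun z => G.b z.1 θ μ z.2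

/-- The set `{x | A x ≤ b}`. -/
def feasibleSet (θ : Param p) (μ : Fin q → ℝ) : Set (Profile n m) :=
  {x | G.A θ μ *ᵥ x ≤ G.rhs θ μ}

theorem A_mulVec (θ : Param p) (μ : Fin q → ℝ) (x : Profile n m) (i : Fin n) (r : Fin l) :
    (G.A θ μ *ᵥ x) (i, r) = (G.B i θ μ *ᵥ own i x + G.D i θ μ *ᵥ others i x) r := by
  simp only [Matrix.mulVec, dotProduct, Pi.add_apply, own, others, A, Matrix.of_apply]
  rw [Fintype.sum_prod_type, Fintype.sum_prod_type]
  rw [← Fintype.sum_subtype_add_sum_subtype (fun j : Fin n => j = i)]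
  congr 1
  · refine (Finset.sum_eq_single (M := ℝ) (⟨i, rfl⟩ : {j : Fin n // j = i})
      (fun j _ hj => absurd (Subtype.ext j.2) hj)
      (fun h => absurd (@Finset.mem_univ _ (_) _) h)).trans ?_
    exact Finset.sum_congr rfl fun s _ => by rw [dif_pos rfl]
  · refine Finset.sum_congr rfl fun j _ => Finset.sum_congr rfl fun s _ => ?_
    rw [dif_neg j.2]

theorem mem_feasibleSet_iff (θ : Param p) (μ : Fin q → ℝ) (x : Profile n m) :
    x ∈ G.feasibleSet θ μ ↔ ∀ i, G.AgentFeasible i θ μ x := by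
  constructor
  · intro h i r
    have := h (i, r)
    rwa [A_mulVec] at this
  · rintro h ⟨i, r⟩
    have := h i r
    rwa [A_mulVec]

/-- The function `Φ(x; θ, μ) = (1/2) xᵀ R x + cᵀ x`. -/
def potential (θ : Param p) (μ : Fin q → ℝ) (x : Profile n m) : ℝ :=
  (1 / 2) * (x ⬝ᵥ (G.R θ μ *ᵥ x)) + G.c θ μ ⬝ᵥ x

/-- The game is a potential game at `(θ, μ)` with the convex quadratic potential `Φ`: the Nash
equilibria are exactly the minimizers of `Φ` subject to the constraints of all agents. -/
def IsPotentialAt (θ : Param p) (μ : Fin q → ℝ) : Prop :=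
  (G.R θ μ).PosSemidef ∧
    ∀ x, G.IsNash θ μ x ↔
      x ∈ G.feasibleSet θ μ ∧ ∀ y ∈ G.feasibleSet θ μ, G.potential θ μ x ≤ G.potential θ μ y

/-- The Karush–Kuhn–Tucker conditions. -/
def IsKKT (θ : Param p) (μ : Fin q → ℝ) (x : Profile n m) (lam : Dual n l) : Prop :=
  G.R θ μ *ᵥ x + G.c θ μ + (G.A θ μ)ᵀ *ᵥ lam = 0 ∧
    x ∈ G.feasibleSet θ μ ∧ 0 ≤ lam ∧ (G.rhs θ μ - G.A θ μ *ᵥ x) ⬝ᵥ lam = 0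

/-- The Nash equilibrium induced by `(θ, μ)`. -/
def equilibrium (θ : Param p) (μ : Fin q → ℝ) : Profile n m :=
  Classical.epsilon fun x => G.IsNash θ μ x

/-- The dual variables at the Nash equilibrium. -/
def multiplier (θ : Param p) (μ : Fin q → ℝ) : Dual n l :=
  Classical.epsilon fun lam => G.IsKKT θ μ (G.equilibrium θ μ) lam

/-- The set of constraints that are tight at `x`. -/
def tightSet (θ : Param p) (μ : Fin q → ℝ) (x : Profile n m) : Set (Fin n × Fin l) :=
  {z | G.rhs θ μ z - (G.A θ μ *ᵥ x) z = 0}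

/-- The active set `Z(θ)` at the Nash equilibrium. -/
def activeSet (θ : Param p) (μ : Fin q → ℝ) : Set (Fin n × Fin l) :=
  G.tightSet θ μ (G.equilibrium θ μ)

/-- The set `Y(θ)` of constraints whose dual variable vanishes. -/
def zeroDualSet (θ : Param p) (μ : Fin q → ℝ) : Set (Fin n × Fin l) :=
  {z | G.multiplier θ μ z = 0}

/-- `Z` is an active set at `(θ, μ)`: the set of tight constraints of some feasible point. -/
def IsActiveSet (θ : Param p) (μ : Fin q → ℝ) (Z : Set (Fin n × Fin l)) : Prop :=
  ∃ x ∈ G.feasibleSet θ μ, Z = G.tightSet θ μ x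

open Classical in
/-- The matrix `S(Z, θ)`, with block rows `(R, Aᵀ)`, `(-A_Z, 0)` and `(0, I_Y)`, where `Y` is the
complement of `Z`.  The rows of the last two blocks are listed in the order of the constraints,
which makes the matrix square; `infNorm (S⁻¹)ᵀ` does not depend on that order. -/
def S (Z : Set (Fin n × Fin l)) (θ : Param p) (μ : Fin q → ℝ) :
    Matrix ((Fin n × Fin m) ⊕ (Fin n × Fin l)) ((Fin n × Fin m) ⊕ (Fin n × Fin l)) ℝ :=
  Matrix.fromBlocks (G.R θ μ) (G.A θ μ)ᵀ
    (Matrix.of fun z w => if z ∈ Z then -G.A θ μ z w else 0)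
    (Matrix.diagonal fun z => if z ∈ Z then 0 else 1)

open Classical in
/-- The strategy profile `x_Z(θ)`: the first component of the solution `(x, λ)` of
`R x + c + Aᵀ λ = 0`, `b_Z - A_Z x = 0`, `λ_Y = 0`. -/
def profileOf (Z : Set (Fin n × Fin l)) (θ : Param p) (μ : Fin q → ℝ) : Profile n m :=
  fun w => ((G.S Z θ μ)⁻¹ *ᵥ
    Sum.elim (-G.c θ μ) (fun z => if z ∈ Z then -G.rhs θ μ z else 0)) (Sum.inl w)

/-- The loss `‖x(θ) - x̄‖²` of one data point `(x̄, μ)`. -/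
def loss (xbar : Profile n m) (μ : Fin q → ℝ) (θ : Param p) : ℝ :=
  ∑ w, (G.equilibrium θ μ w - xbar w) ^ 2

/-- The loss `‖x_Z(θ) - x̄‖²` of one data point for a fixed active set `Z`. -/
def lossOn (Z : Set (Fin n × Fin l)) (xbar : Profile n m) (μ : Fin q → ℝ) (θ : Param p) : ℝ :=
  ∑ w, (G.profileOf Z θ μ w - xbar w) ^ 2

/-- The gradient that the active-set algorithm evaluates at `θ` for one data point: the gradient
at `θ` of the loss for the active set `Z(θ)`, which is kept fixed in the differentiation. -/
def lossGrad (xbar : Profile n m) (μ : Fin q → ℝ) (θ : Param p) : Param p :=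
  gradient (G.lossOn (G.activeSet θ μ) xbar μ) θ

/-- The matrix of the `j`-th partial derivatives of `R`. -/
def dR (j : Fin p) (θ : Param p) (μ : Fin q → ℝ) : Matrix (Fin n × Fin m) (Fin n × Fin m) ℝ :=
  Matrix.of fun v w => pderiv j (fun θ' => G.R θ' μ v w) θ

/-- The matrix of the `j`-th partial derivatives of `A`. -/
def dA (j : Fin p) (θ : Param p) (μ : Fin q → ℝ) : Matrix (Fin n × Fin l) (Fin n × Fin m) ℝ :=
  Matrix.of fun z w => pderiv j (fun θ' => G.A θ' μ z w) θ

/-- The vector of the `j`-th partial derivatives of `c`. -/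
def dc (j : Fin p) (θ : Param p) (μ : Fin q → ℝ) : Profile n m :=
  fun w => pderiv j (fun θ' => G.c θ' μ w) θ

/-- The vector of the `j`-th partial derivatives of the right-hand side `b`. -/
def db (j : Fin p) (θ : Param p) (μ : Fin q → ℝ) : Dual n l :=
  fun z => pderiv j (fun θ' => G.rhs θ' μ z) θ

/-- The standing setting on the parameter space `Θ` for the contexts `μ 0, …, μ (K - 1)` of the
data: a potential game with continuously differentiable coefficients and nonempty feasible
sets. -/
structure Regular {K : ℕ} (Θ : Set (Param p)) (μ : Fin K → Fin q → ℝ) : Prop where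
  isPotential : ∀ θ ∈ Θ, ∀ k, G.IsPotentialAt θ (μ k)
  nonempty : ∀ θ ∈ Θ, ∀ k, (G.feasibleSet θ (μ k)).Nonempty
  contDiff_R : ∀ k v w, ContDiffOn ℝ 1 (fun θ => G.R θ (μ k) v w) Θ
  contDiff_c : ∀ k w, ContDiffOn ℝ 1 (fun θ => G.c θ (μ k) w) Θ
  contDiff_A : ∀ k z w, ContDiffOn ℝ 1 (fun θ => G.A θ (μ k) z w) Θ
  contDiff_b : ∀ k z, ContDiffOn ℝ 1 (fun θ => G.rhs θ (μ k) z) Θ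

/-- Constraint qualifications: the linear independence constraint qualification (at every
feasible point the tight rows of `A` are linearly independent) and uniform boundedness. -/
structure ConstraintQualifications {K : ℕ} (Θ : Set (Param p)) (μ : Fin K → Fin q → ℝ) :
    Prop where
  licq : ∀ θ ∈ Θ, ∀ k, ∀ x ∈ G.feasibleSet θ (μ k),
    LinearIndependent ℝ (fun z : G.tightSet θ (μ k) x => (G.A θ (μ k)).row z)
  bounded : ∃ M : ℝ, ∀ θ ∈ Θ, ∀ k, ∀ x ∈ G.feasibleSet θ (μ k), ‖x‖ ≤ M

/-- Well-behaved derivatives.  The last condition only matters if `A` depends on `θ`. -/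
structure WellBehavedDerivatives {K : ℕ} (Θ : Set (Param p)) (μ : Fin K → Fin q → ℝ) :
    Prop where
  inverse_bounded : ∃ L₀ > 0, ∀ θ ∈ Θ, ∀ k, ∀ Z, G.IsActiveSet θ (μ k) Z →
    IsUnit (G.S Z θ (μ k)).det ∧ infNorm ((G.S Z θ (μ k))⁻¹)ᵀ < L₀
  nondegenerate : ∀ᵐ θ ∂(volume.restrict Θ), ∀ k,
    G.activeSet θ (μ k) ∩ G.zeroDualSet θ (μ k) = ∅
  dR_bounded : ∃ L₃ > 0, ∀ k, ∀ θ ∈ Θ, ∀ j, infNorm (G.dR j θ (μ k)) ≤ L₃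
  dc_bounded : ∃ L : ℝ, ∀ k, ∀ θ ∈ Θ, ∀ j, ‖G.dc j θ (μ k)‖ ≤ L
  db_bounded : ∃ L : ℝ, ∀ k, ∀ θ ∈ Θ, ∀ j, ‖G.db j θ (μ k)‖ ≤ L
  dA_bounded : ∃ L : ℝ, ∀ k, ∀ θ ∈ Θ, ∀ j, infNorm (G.dA j θ (μ k)) ≤ L
  dA_multiplier_bounded : ∃ L : ℝ, ∀ k, ∀ θ ∈ Θ, ∀ j,
    ‖(G.dA j θ (μ k))ᵀ *ᵥ G.multiplier θ (μ k)‖ ≤ L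

/-- The field `v ↦ (1/K) ∑ₖ |B_ε(v)|⁻¹ ∫_{B_ε(v)} ∇L(u; {x̄ᵏ}) du`. -/
def smoothedGrad {K : ℕ} (xbar : Fin K → Profile n m) (μ : Fin K → Fin q → ℝ) (ε : ℝ)
    (v : Param p) : Param p :=
  (1 / (K : ℝ)) • ∑ k, ⨍ u in Metric.ball v ε, G.lossGrad (xbar k) (μ k) u

/-- The smoothed loss `g`: the line integral of the averaged gradient field along the segment
from `θ₀` to `θ`. -/
def smoothedLoss {K : ℕ} (xbar : Fin K → Profile n m) (μ : Fin K → Fin q → ℝ) (ε : ℝ)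
    (θ₀ θ : Param p) : ℝ :=
  ∫ s in (0 : ℝ)..1, inner ℝ (G.smoothedGrad xbar μ ε (θ₀ + s • (θ - θ₀))) (θ - θ₀)

/-- `θ` is a run of the active-set algorithm whose gradient is always taken at a point drawn
uniformly from the `ε`-ball around the current iterate.  At step `t` the algorithm draws a data
point `κ t` uniformly and a displacement `U t` uniformly from the ball of radius `ε` around `0`,
all draws being independent.  The run stays where these gradients are defined: the balls from
which it samples lie in `Θ`. -/
structure IsRun {K : ℕ} (xbar : Fin K → Profile n m) (μ : Fin K → Fin q → ℝ)
    (Θ : Set (Param p)) (ε : ℝ) (η : ℕ → ℝ) (θ₀ : Param p)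
    {Ω : Type*} [MeasurableSpace Ω] (P : Measure Ω)
    (κ : ℕ → Ω → Fin K) (U : ℕ → Ω → Param p) (θ : ℕ → Ω → Param p) : Prop where
  measurable_index : ∀ t, Measurable (κ t)
  measurable_shift : ∀ t, Measurable (U t)
  uniform_index : ∀ t, pdf.IsUniform (κ t) univ P Measure.count
  uniform_shift : ∀ t, pdf.IsUniform (U t) (Metric.ball 0 ε) P volume
  indep_step : ∀ t, ProbabilityTheory.IndepFun (κ t) (U t) P
  indep_steps : ProbabilityTheory.iIndepFun (fun t ω => (κ t ω, U t ω)) P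
  init : ∀ ω, θ 0 ω = θ₀
  step : ∀ t ω, θ (t + 1) ω =
    θ t ω - η t • G.lossGrad (xbar (κ t ω)) (μ (κ t ω)) (θ t ω + U t ω)
  stays : ∀ᵐ ω ∂P, ∀ t, Metric.closedBall (θ t ω) ε ⊆ Θ

end Game

end InverseGame

end

namespace InverseGame.Game

variable {n m l p q : ℕ} (G : InverseGame.Game n m l p q)

/-! ### The equilibrium problem at fixed parameters -/

/-! At fixed parameters the equilibrium minimizes a convex quadratic over a compact polyhedron.
Invertibility of `S` at active sets makes the minimizer unique (`IsPotentialMin.unique`) and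
produces its multipliers (`IsPotentialMin.isKKT`), so equilibrium and multipliers solve the linear
system of the active set. Under strict complementarity the solution of that system stays a KKT pair
nearby, so the loss is locally a smooth function whose gradient is the one used by the algorithm
(`hasGradientAt_loss`).

The loss is also Lipschitz on `Θ`, across changes of the active set (`exists_lipschitzOnWith_loss`).
Only finitely many sets can be active, and each one that recurs near a point still represents the
equilibrium at that point, by closedness of the KKT conditions (`eq_of_frequently_activeSet`).
Differentiating the linear systems gives a uniform bound on their derivatives, hence on small
increments of the loss at every point, and convexity of `Θ` turns this into a Lipschitz bound
(`lipschitzOnWith_of_calm`).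

For a Lipschitz function, averaging over balls commutes with taking the almost everywhere defined
gradient (`hasGradientAt_average`). The averaged gradient is Lipschitz in the center, because two
balls differ by a volume of the order of the distance of their centers (`norm_average_sub_le`).
Thus, on the convex set of centers whose closed ball lies in `Θ`, the smoothed loss is the averaged
loss up to a constant (`integral_gradient_segment`).

What remains is stochastic gradient descent with bounded unbiased gradients. Sampling points avoid
null sets almost surely, so measurable fields may replace the gradients of the algorithm
(`IsSampling.ae_eq_sampledIterate`), and independence identifies the mean of a step
(`IsSampling.integral_inner`). Summing the descent inequality shows that `η t` times the expected
squared gradient norm is summable. This expectation changes by at most a multiple of `η t` per step,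
so it tends to zero along the whole sequence (`tendsto_zero_of_summable_mul`). -/

open Classical in
/-- The right-hand side of the linear system with matrix `S Z`. -/
noncomputable def systemRHS (Z : Set (Fin n × Fin l)) (θ : Param p) (μ : Fin q → ℝ) :
    (Fin n × Fin m) ⊕ (Fin n × Fin l) → ℝ :=
  Sum.elim (-G.c θ μ) (fun z => if z ∈ Z then -G.rhs θ μ z else 0)

/-- The solution `(x, λ)` of the linear system with matrix `S Z`. -/
noncomputable def systemSol (Z : Set (Fin n × Fin l)) (θ : Param p) (μ : Fin q → ℝ) :
    (Fin n × Fin m) ⊕ (Fin n × Fin l) → ℝ :=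
  (G.S Z θ μ)⁻¹ *ᵥ G.systemRHS Z θ μ

/-- The dual component of the solution of the linear system with matrix `S Z`. -/
noncomputable def dualOf (Z : Set (Fin n × Fin l)) (θ : Param p) (μ : Fin q → ℝ) : Dual n l :=
  fun z => G.systemSol Z θ μ (Sum.inr z)

variable {G} {θ : Param p} {μ : Fin q → ℝ} {Z : Set (Fin n × Fin l)}

theorem elim_profileOf_dualOf (Z : Set (Fin n × Fin l)) (θ : Param p) (μ : Fin q → ℝ) :
    Sum.elim (G.profileOf Z θ μ) (G.dualOf Z θ μ) = G.systemSol Z θ μ := by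
  ext (w | z) <;> rfl

theorem S_mulVec_inl (x : Profile n m) (lam : Dual n l) (w : Fin n × Fin m) :
    (G.S Z θ μ *ᵥ Sum.elim x lam) (Sum.inl w) =
      (G.R θ μ *ᵥ x) w + ((G.A θ μ)ᵀ *ᵥ lam) w := by
  simp [S, Matrix.fromBlocks_mulVec]

open Classical in
theorem S_mulVec_inr (x : Profile n m) (lam : Dual n l) (z : Fin n × Fin l) :
    (G.S Z θ μ *ᵥ Sum.elim x lam) (Sum.inr z) =
      if z ∈ Z then -(G.A θ μ *ᵥ x) z else lam z := by
  simp only [S, Matrix.fromBlocks_mulVec, Sum.elim_inr, Pi.add_apply, Sum.elim_comp_inl,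
    Sum.elim_comp_inr, Matrix.mulVec_diagonal]
  split_ifs with h <;> simp [Matrix.mulVec, dotProduct, h]

theorem eq_systemSol (hdet : IsUnit (G.S Z θ μ).det) {v : (Fin n × Fin m) ⊕ (Fin n × Fin l) → ℝ}
    (h : G.S Z θ μ *ᵥ v = G.systemRHS Z θ μ) : v = G.systemSol Z θ μ := by
  rw [systemSol, ← h, Matrix.mulVec_mulVec, Matrix.nonsing_inv_mul _ hdet, Matrix.one_mulVec]

theorem S_mulVec_systemSol (hdet : IsUnit (G.S Z θ μ).det) :
    G.S Z θ μ *ᵥ G.systemSol Z θ μ = G.systemRHS Z θ μ := by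
  rw [systemSol, Matrix.mulVec_mulVec, Matrix.mul_nonsing_inv _ hdet, Matrix.one_mulVec]

theorem stationary_systemSol (hdet : IsUnit (G.S Z θ μ).det) :
    G.R θ μ *ᵥ G.profileOf Z θ μ + G.c θ μ + (G.A θ μ)ᵀ *ᵥ G.dualOf Z θ μ = 0 := by
  ext w
  have h := congrFun (S_mulVec_systemSol hdet) (Sum.inl w)
  rw [← elim_profileOf_dualOf, S_mulVec_inl] at h
  simp only [systemRHS, Sum.elim_inl, Pi.neg_apply] at h
  simp only [Pi.add_apply, Pi.zero_apply]
  linarith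

theorem A_mulVec_profileOf (hdet : IsUnit (G.S Z θ μ).det) {z : Fin n × Fin l} (hz : z ∈ Z) :
    (G.A θ μ *ᵥ G.profileOf Z θ μ) z = G.rhs θ μ z := by
  have h := congrFun (S_mulVec_systemSol hdet) (Sum.inr z)
  rw [← elim_profileOf_dualOf, S_mulVec_inr] at h
  simpa [systemRHS, hz] using h

theorem dualOf_eq_zero (hdet : IsUnit (G.S Z θ μ).det) {z : Fin n × Fin l} (hz : z ∉ Z) :
    G.dualOf Z θ μ z = 0 := by
  have h := congrFun (S_mulVec_systemSol hdet) (Sum.inr z)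
  rw [← elim_profileOf_dualOf, S_mulVec_inr] at h
  simpa [systemRHS, hz] using h

/-- A solution of the linear system that is primal and dual feasible satisfies the
Karush–Kuhn–Tucker conditions. -/
theorem isKKT_of_feasible (hdet : IsUnit (G.S Z θ μ).det)
    (hx : G.profileOf Z θ μ ∈ G.feasibleSet θ μ) (hlam : 0 ≤ G.dualOf Z θ μ) :
    G.IsKKT θ μ (G.profileOf Z θ μ) (G.dualOf Z θ μ) := by
  refine ⟨stationary_systemSol hdet, hx, hlam, ?_⟩
  refine Finset.sum_eq_zero fun z _ => ?_
  by_cases hz : z ∈ Z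
  · simp [A_mulVec_profileOf hdet hz]
  · simp [dualOf_eq_zero hdet hz]

theorem IsKKT.slack_mul_eq_zero {x : Profile n m} {lam : Dual n l} (h : G.IsKKT θ μ x lam)
    (z : Fin n × Fin l) : (G.rhs θ μ z - (G.A θ μ *ᵥ x) z) * lam z = 0 := by
  obtain ⟨-, hx, hlam, h0⟩ := h
  refine (Finset.sum_eq_zero_iff_of_nonneg (f := fun z =>
    (G.rhs θ μ z - (G.A θ μ *ᵥ x) z) * lam z) (s := Finset.univ) fun z _ => ?_).1 h0 z
      (Finset.mem_univ _)
  exact mul_nonneg (sub_nonneg.2 (hx z)) (hlam z)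

theorem IsKKT.eq_zero_of_notMem {x : Profile n m} {lam : Dual n l} (h : G.IsKKT θ μ x lam)
    {z : Fin n × Fin l} (hz : z ∉ G.tightSet θ μ x) : lam z = 0 :=
  (mul_eq_zero.1 (h.slack_mul_eq_zero z)).resolve_left hz

/-- A KKT pair solves the linear system for every set of tight constraints that contains the
support of the dual variables. -/
theorem IsKKT.elim_eq_systemSol {x : Profile n m} {lam : Dual n l} (h : G.IsKKT θ μ x lam)
    (hdet : IsUnit (G.S Z θ μ).det) (hZ : Z ⊆ G.tightSet θ μ x) (hlam : ∀ z ∉ Z, lam z = 0) :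
    Sum.elim x lam = G.systemSol Z θ μ := by
  refine eq_systemSol hdet ?_
  ext (w | z)
  · have := congrFun h.1 w
    simp only [Pi.add_apply, Pi.zero_apply] at this
    rw [S_mulVec_inl]
    simp only [systemRHS, Sum.elim_inl, Pi.neg_apply]
    linarith
  · rw [S_mulVec_inr]
    by_cases hz : z ∈ Z
    · have : G.rhs θ μ z - (G.A θ μ *ᵥ x) z = 0 := hZ hz
      simp only [systemRHS, Sum.elim_inr, hz, if_true]
      linarith
    · simp [systemRHS, hz, hlam z hz]

/-! ### First-order optimality for the quadratic potential -/

theorem potential_add (hR : (G.R θ μ).PosSemidef) (x d : Profile n m) :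
    G.potential θ μ (x + d) = G.potential θ μ x + (G.R θ μ *ᵥ x + G.c θ μ) ⬝ᵥ d +
      (1 / 2) * (d ⬝ᵥ (G.R θ μ *ᵥ d)) := by
  have hs : (G.R θ μ)ᵀ = G.R θ μ := by
    simpa [Matrix.conjTranspose_eq_transpose_of_trivial] using hR.1.eq
  have h : x ⬝ᵥ (G.R θ μ *ᵥ d) = (G.R θ μ *ᵥ x) ⬝ᵥ d := by
    rw [Matrix.dotProduct_mulVec, ← Matrix.mulVec_transpose, hs]
  simp only [potential, Matrix.mulVec_add, add_dotProduct, dotProduct_add, h]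
  rw [dotProduct_comm d (G.R θ μ *ᵥ x)]
  ring

/-- `x` minimizes the potential over the feasible set. -/
def IsPotentialMin (G : InverseGame.Game n m l p q) (θ : Param p) (μ : Fin q → ℝ)
    (x : Profile n m) : Prop :=
  x ∈ G.feasibleSet θ μ ∧ ∀ y ∈ G.feasibleSet θ μ, G.potential θ μ x ≤ G.potential θ μ y

/-- By stationarity the linear term of the exact expansion at `x` equals the pairing of `lam` with
the slack at `y` minus that with the slack at `x`. The former is nonnegative, the latter vanishes,
and the quadratic term is nonnegative. -/
theorem IsKKT.isPotentialMin (hR : (G.R θ μ).PosSemidef) {x : Profile n m} {lam : Dual n l}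
    (h : G.IsKKT θ μ x lam) : G.IsPotentialMin θ μ x := by
  refine ⟨h.2.1, fun y hy => ?_⟩
  have h1 := potential_add hR x (y - x)
  rw [add_sub_cancel] at h1
  have h2 : 0 ≤ (y - x) ⬝ᵥ (G.R θ μ *ᵥ (y - x)) := by
    simpa using hR.dotProduct_mulVec_nonneg (y - x)
  have h3 : G.R θ μ *ᵥ x + G.c θ μ = -((G.A θ μ)ᵀ *ᵥ lam) := eq_neg_of_add_eq_zero_left h.1
  have h4 : (G.R θ μ *ᵥ x + G.c θ μ) ⬝ᵥ (y - x) =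
      (G.rhs θ μ - G.A θ μ *ᵥ y) ⬝ᵥ lam - (G.rhs θ μ - G.A θ μ *ᵥ x) ⬝ᵥ lam := by
    rw [h3, neg_dotProduct, Matrix.mulVec_transpose, ← Matrix.dotProduct_mulVec, Matrix.mulVec_sub,
      ← sub_dotProduct, dotProduct_comm, ← neg_dotProduct]
    congr 1
    abel
  have h5 : 0 ≤ (G.rhs θ μ - G.A θ μ *ᵥ y) ⬝ᵥ lam :=
    Finset.sum_nonneg fun z _ => mul_nonneg (sub_nonneg.2 (hy z)) (h.2.2.1 z)
  rw [h1, h4, h.2.2.2]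
  linarith

/-- Such a `d` is a feasible direction: constraints that are not tight have room for a short step.
Dividing the increment of the potential by the step length and letting it tend to zero gives the
sign. -/
theorem IsPotentialMin.gradient_nonneg (hR : (G.R θ μ).PosSemidef) {x : Profile n m}
    (h : G.IsPotentialMin θ μ x) {d : Profile n m}
    (hd : ∀ z ∈ G.tightSet θ μ x, (G.A θ μ *ᵥ d) z ≤ 0) :
    0 ≤ (G.R θ μ *ᵥ x + G.c θ μ) ⬝ᵥ d := by
  have hfeas : ∀ᶠ t in nhdsWithin (0 : ℝ) (Ioi 0), x + t • d ∈ G.feasibleSet θ μ := by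
    have : ∀ z, ∀ᶠ t in nhdsWithin (0 : ℝ) (Ioi 0), (G.A θ μ *ᵥ (x + t • d)) z ≤ G.rhs θ μ z := by
      intro z
      by_cases hz : z ∈ G.tightSet θ μ x
      · filter_upwards [self_mem_nhdsWithin] with t ht
        have h1 : G.rhs θ μ z - (G.A θ μ *ᵥ x) z = 0 := hz
        have h2 := mul_nonneg (le_of_lt (mem_Ioi.1 ht)) (neg_nonneg.2 (hd z hz))
        simp only [Matrix.mulVec_add, Matrix.mulVec_smul, Pi.add_apply, Pi.smul_apply, smul_eq_mul]
        linarith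
      · have hlt : (G.A θ μ *ᵥ x) z < G.rhs θ μ z :=
          lt_of_le_of_ne (h.1 z) fun he => hz (sub_eq_zero.2 he.symm)
        have hc : Filter.Tendsto (fun t : ℝ => (G.A θ μ *ᵥ x) z + t * (G.A θ μ *ᵥ d) z)
            (nhdsWithin 0 (Ioi 0)) (nhds ((G.A θ μ *ᵥ x) z)) := by
          have : Continuous (fun t : ℝ => (G.A θ μ *ᵥ x) z + t * (G.A θ μ *ᵥ d) z) := by fun_prop
          have := this.tendsto 0
          simp only [zero_mul, add_zero] at this
          exact this.mono_left nhdsWithin_le_nhds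
        filter_upwards [hc.eventually (gt_mem_nhds hlt)] with t ht
        simp only [Matrix.mulVec_add, Matrix.mulVec_smul, Pi.add_apply, Pi.smul_apply, smul_eq_mul]
        exact ht.le
    filter_upwards [Filter.eventually_all.2 this] with t ht using ht
  have hc : Filter.Tendsto (fun t : ℝ => (G.R θ μ *ᵥ x + G.c θ μ) ⬝ᵥ d +
      t * ((1 / 2) * (d ⬝ᵥ (G.R θ μ *ᵥ d)))) (nhdsWithin 0 (Ioi 0))
      (nhds ((G.R θ μ *ᵥ x + G.c θ μ) ⬝ᵥ d)) := by
    have : Continuous (fun t : ℝ => (G.R θ μ *ᵥ x + G.c θ μ) ⬝ᵥ d +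
      t * ((1 / 2) * (d ⬝ᵥ (G.R θ μ *ᵥ d)))) := by fun_prop
    have := this.tendsto 0
    simp only [zero_mul, add_zero] at this
    exact this.mono_left nhdsWithin_le_nhds
  refine ge_of_tendsto hc ?_
  filter_upwards [hfeas, self_mem_nhdsWithin] with t ht ht0
  have h1 := h.2 _ ht
  rw [potential_add hR] at h1
  simp only [Matrix.mulVec_smul, dotProduct_smul, smul_dotProduct, smul_eq_mul] at h1
  have h2 : 0 ≤ t * ((G.R θ μ *ᵥ x + G.c θ μ) ⬝ᵥ d + t * ((1 / 2) * (d ⬝ᵥ (G.R θ μ *ᵥ d)))) := by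
    linarith
  exact nonneg_of_mul_nonneg_right h2 ht0

/-- The pair `(d, 0)` lies in the kernel of `S`. This turns invertibility into definiteness of `R`
along the directions that keep the constraints of `Z` tight. -/
theorem eq_zero_of_S_mulVec (hdet : IsUnit (G.S Z θ μ).det) {d : Profile n m}
    (h1 : G.R θ μ *ᵥ d = 0) (h2 : ∀ z ∈ Z, (G.A θ μ *ᵥ d) z = 0) : d = 0 := by
  have h : G.S Z θ μ *ᵥ Sum.elim d 0 = 0 := by
    ext (w | z)
    · rw [S_mulVec_inl, h1]
      simp
    · rw [S_mulVec_inr]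
      split_ifs with hz
      · simp [h2 z hz]
      · simp
  have h3 := Matrix.eq_zero_of_mulVec_eq_zero hdet.ne_zero h
  ext w
  exact congrFun h3 (Sum.inl w)

theorem R_mulVec_eq_zero (hR : (G.R θ μ).PosSemidef) {d : Profile n m}
    (h : d ⬝ᵥ (G.R θ μ *ᵥ d) = 0) : G.R θ μ *ᵥ d = 0 :=
  (hR.dotProduct_mulVec_zero_iff d).1 (by simpa using h)

theorem add_dotProduct_sub (x y c : Profile n m) :
    (G.R θ μ *ᵥ y + c) ⬝ᵥ (y - x) - (G.R θ μ *ᵥ x + c) ⬝ᵥ (y - x) =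
      (y - x) ⬝ᵥ (G.R θ μ *ᵥ (y - x)) := by
  rw [← sub_dotProduct, add_sub_add_right_eq_sub, ← Matrix.mulVec_sub, dotProduct_comm]

/-- The first-order conditions at both points and monotonicity of the gradient force `R (y - x) =
0`. A constraint tight at the midpoint is tight at both ends, so `y - x` is annihilated by the rows
active at the midpoint. The midpoint is used because its tight set is an active set, for which `S`
is invertible. -/
theorem IsPotentialMin.unique (hR : (G.R θ μ).PosSemidef)
    (hdet : ∀ Z, G.IsActiveSet θ μ Z → IsUnit (G.S Z θ μ).det) {x y : Profile n m}
    (hx : G.IsPotentialMin θ μ x) (hy : G.IsPotentialMin θ μ y) : x = y := by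
  have h1 : 0 ≤ (G.R θ μ *ᵥ x + G.c θ μ) ⬝ᵥ (y - x) := by
    refine hx.gradient_nonneg hR fun z hz => ?_
    have h1 : G.rhs θ μ z - (G.A θ μ *ᵥ x) z = 0 := hz
    have h2 := hy.1 z
    rw [Matrix.mulVec_sub, Pi.sub_apply]
    linarith
  have h2 : 0 ≤ (G.R θ μ *ᵥ y + G.c θ μ) ⬝ᵥ (x - y) := by
    refine hy.gradient_nonneg hR fun z hz => ?_
    have h1 : G.rhs θ μ z - (G.A θ μ *ᵥ y) z = 0 := hz
    have h2 := hx.1 z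
    rw [Matrix.mulVec_sub, Pi.sub_apply]
    linarith
  have h3 : (G.R θ μ *ᵥ y + G.c θ μ) ⬝ᵥ (x - y) = -((G.R θ μ *ᵥ y + G.c θ μ) ⬝ᵥ (y - x)) := by
    rw [← dotProduct_neg, neg_sub]
  have h4 := add_dotProduct_sub (G := G) (θ := θ) (μ := μ) x y (G.c θ μ)
  have h5 : 0 ≤ (y - x) ⬝ᵥ (G.R θ μ *ᵥ (y - x)) := by
    simpa using hR.dotProduct_mulVec_nonneg (y - x)
  have hRd : G.R θ μ *ᵥ (y - x) = 0 := R_mulVec_eq_zero hR (by linarith)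
  have hmid : ∀ z, (G.A θ μ *ᵥ ((1 / 2 : ℝ) • (x + y))) z =
      (1 / 2) * ((G.A θ μ *ᵥ x) z + (G.A θ μ *ᵥ y) z) := fun z => by
    simp only [Matrix.mulVec_add, Matrix.mulVec_smul, Pi.add_apply, Pi.smul_apply, smul_eq_mul]
  have hfeas : (1 / 2 : ℝ) • (x + y) ∈ G.feasibleSet θ μ := fun z => by
    have := hx.1 z
    have := hy.1 z
    rw [hmid]
    linarith
  refine (sub_eq_zero.1 (eq_zero_of_S_mulVec (hdet _ ⟨_, hfeas, rfl⟩) hRd fun z hz => ?_)).symm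
  have h6 : G.rhs θ μ z - (G.A θ μ *ᵥ ((1 / 2 : ℝ) • (x + y))) z = 0 := hz
  have := hx.1 z
  have := hy.1 z
  rw [hmid] at h6
  rw [Matrix.mulVec_sub, Pi.sub_apply]
  linarith

/-- Invertibility of `S` replaces a separation argument: the linear system of the tight set always
has a solution, its primal part must be `x`, and the sign of each multiplier is read off by testing
with one suitable direction. -/
theorem IsPotentialMin.isKKT (hR : (G.R θ μ).PosSemidef) {x : Profile n m}
    (hx : G.IsPotentialMin θ μ x) (hdet : IsUnit (G.S (G.tightSet θ μ x) θ μ).det) :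
    G.profileOf (G.tightSet θ μ x) θ μ = x ∧
      G.IsKKT θ μ x (G.dualOf (G.tightSet θ μ x) θ μ) := by
  set Z := G.tightSet θ μ x with hZ
  set y := G.profileOf Z θ μ with hy
  set lam := G.dualOf Z θ μ with hlam
  have hA : ∀ z ∈ Z, (G.A θ μ *ᵥ (y - x)) z = 0 := fun z hz => by
    have h1 : G.rhs θ μ z - (G.A θ μ *ᵥ x) z = 0 := hz
    rw [Matrix.mulVec_sub, Pi.sub_apply, A_mulVec_profileOf hdet hz, h1]
  have h1 : 0 ≤ (G.R θ μ *ᵥ x + G.c θ μ) ⬝ᵥ (y - x) :=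
    hx.gradient_nonneg hR fun z hz => (hA z hz).le
  have hdual : ∀ d : Profile n m, (G.R θ μ *ᵥ y + G.c θ μ) ⬝ᵥ d = -(lam ⬝ᵥ (G.A θ μ *ᵥ d)) := by
    intro d
    rw [eq_neg_of_add_eq_zero_left (stationary_systemSol hdet), neg_dotProduct,
      Matrix.mulVec_transpose, ← Matrix.dotProduct_mulVec]
  have h2 : (G.R θ μ *ᵥ y + G.c θ μ) ⬝ᵥ (y - x) = 0 := by
    rw [hdual, neg_eq_zero]
    refine Finset.sum_eq_zero fun z _ => ?_
    by_cases hz : z ∈ Z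
    · rw [hA z hz, mul_zero]
    · rw [hlam, dualOf_eq_zero hdet hz, zero_mul]
  have h4 := add_dotProduct_sub (G := G) (θ := θ) (μ := μ) x y (G.c θ μ)
  have h5 : 0 ≤ (y - x) ⬝ᵥ (G.R θ μ *ᵥ (y - x)) := by
    simpa using hR.dotProduct_mulVec_nonneg (y - x)
  have hRd : G.R θ μ *ᵥ (y - x) = 0 := R_mulVec_eq_zero hR (by linarith)
  have hyx : y = x := sub_eq_zero.1 (eq_zero_of_S_mulVec hdet hRd hA)
  refine ⟨hyx, ?_⟩
  rw [← hyx]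
  refine isKKT_of_feasible hdet (by rw [← hy, hyx]; exact hx.1) fun z => ?_
  by_cases hz : z ∈ Z
  swap
  · exact (dualOf_eq_zero hdet hz).ge
  -- The primal part of `v` relaxes constraint `z` at unit rate and keeps the other constraints of
  -- `Z` tight. The derivative of the potential along this feasible direction is exactly the
  -- multiplier of `z`.
  obtain ⟨v, hv⟩ : ∃ v, G.S Z θ μ *ᵥ v = Pi.single (Sum.inr z) 1 :=
    ⟨(G.S Z θ μ)⁻¹ *ᵥ Pi.single (Sum.inr z) 1, by
      rw [Matrix.mulVec_mulVec, Matrix.mul_nonsing_inv _ hdet, Matrix.one_mulVec]⟩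
  have hv' : Sum.elim (v ∘ Sum.inl) (v ∘ Sum.inr) = v := Sum.elim_comp_inl_inr v
  rw [← hv'] at hv
  have hAd : ∀ z' ∈ Z, (G.A θ μ *ᵥ (v ∘ Sum.inl)) z' = if z' = z then -1 else 0 := by
    intro z' hz'
    have := congrFun hv (Sum.inr z')
    rw [S_mulVec_inr, if_pos hz', Pi.single_apply] at this
    split_ifs with he
    · rw [if_pos (by rw [he])] at this
      linarith
    · rw [if_neg (by simpa using he)] at this
      linarith
  have h6 : 0 ≤ (G.R θ μ *ᵥ x + G.c θ μ) ⬝ᵥ (v ∘ Sum.inl) := by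
    refine hx.gradient_nonneg hR fun z' hz' => ?_
    rw [hAd z' hz']
    split_ifs <;> norm_num
  rw [← hyx, hdual, dotProduct, Finset.sum_eq_single z, hAd z hz, if_pos rfl] at h6
  · simpa using h6
  · intro z' _ hne
    by_cases hz' : z' ∈ Z
    · rw [hAd z' hz', if_neg hne, mul_zero]
    · rw [hlam, dualOf_eq_zero hdet hz', zero_mul]
  · simp

end InverseGame.Game

namespace InverseGame

/-! ### Matrices depending differentiably on parameters -/

theorem differentiableAt_det {E ι : Type*} [NormedAddCommGroup E] [NormedSpace ℝ E]
    [Fintype ι] [DecidableEq ι] {M : E → Matrix ι ι ℝ} {x : E}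
    (h : ∀ i j, DifferentiableAt ℝ (fun y => M y i j) x) :
    DifferentiableAt ℝ (fun y => (M y).det) x := by
  simp only [Matrix.det_apply]
  fun_prop

/-- By Cramer's rule the entries are quotients of determinants, which are polynomials in the entries
of `M`. -/
theorem differentiableAt_inv_apply {E ι : Type*} [NormedAddCommGroup E] [NormedSpace ℝ E]
    [Fintype ι] [DecidableEq ι] {M : E → Matrix ι ι ℝ} {x : E}
    (h : ∀ i j, DifferentiableAt ℝ (fun y => M y i j) x) (hdet : IsUnit (M x).det) (i j : ι) :
    DifferentiableAt ℝ (fun y => (M y)⁻¹ i j) x := by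
  simp only [Matrix.inv_def, Ring.inverse_eq_inv', Matrix.smul_apply, smul_eq_mul,
    Matrix.adjugate_apply]
  refine ((differentiableAt_det h).inv hdet.ne_zero).mul (differentiableAt_det fun a b => ?_)
  simp only [Matrix.updateRow_apply]
  split_ifs
  · exact differentiableAt_const _
  · exact h a b

theorem abs_apply_le_infNorm {ι κ : Type*} [Finite ι] [Fintype κ] (M : Matrix ι κ ℝ) (i : ι)
    (j : κ) : |M i j| ≤ infNorm M :=
  (Finset.single_le_sum (fun j _ => abs_nonneg (M i j)) (Finset.mem_univ j)).trans
    (le_ciSup (f := fun i => ∑ j, |M i j|) (Finite.bddAbove_range _) i)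

theorem infNorm_nonneg {ι κ : Type*} [Fintype κ] (M : Matrix ι κ ℝ) : 0 ≤ infNorm M :=
  Real.iSup_nonneg fun _ => Finset.sum_nonneg fun _ _ => abs_nonneg _

theorem abs_mulVec_le {ι κ : Type*} [Finite ι] [Fintype κ] (M : Matrix ι κ ℝ) (v : κ → ℝ)
    (i : ι) : |(M *ᵥ v) i| ≤ infNorm M * ‖v‖ := by
  calc |(M *ᵥ v) i| ≤ ∑ j, |M i j * v j| := Finset.abs_sum_le_sum_abs _ _
    _ ≤ ∑ j, |M i j| * ‖v‖ := Finset.sum_le_sum fun j _ => by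
        rw [abs_mul]
        exact mul_le_mul_of_nonneg_left (norm_le_pi_norm v j) (abs_nonneg _)
    _ = (∑ j, |M i j|) * ‖v‖ := (Finset.sum_mul _ _ _).symm
    _ ≤ infNorm M * ‖v‖ := mul_le_mul_of_nonneg_right
        (le_ciSup (f := fun i => ∑ j, |M i j|) (Finite.bddAbove_range _) i) (norm_nonneg _)

theorem norm_le_of_pderiv_bound {p : ℕ} {f : Param p →L[ℝ] ℝ} {C : ℝ}
    (h : ∀ j, |f (EuclideanSpace.single j 1)| ≤ C) : ‖f‖ ≤ ∑ _j : Fin p, C := by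
  have hC : 0 ≤ ∑ _j : Fin p, C :=
    Finset.sum_nonneg fun j _ => (abs_nonneg _).trans (h j)
  refine f.opNorm_le_bound hC fun v => ?_
  have hv : v = ∑ j, v j • EuclideanSpace.single j (1 : ℝ) := by
    ext i
    simp [Finset.sum_apply, Pi.single_apply]
  have h1 : f v = ∑ j, v j * f (EuclideanSpace.single j 1) := by
    conv_lhs => rw [hv]
    simp
  rw [h1, Finset.sum_mul]
  refine (norm_sum_le _ _).trans (Finset.sum_le_sum fun j _ => ?_)
  rw [norm_mul, mul_comm]
  exact mul_le_mul (h j) (PiLp.norm_apply_le v j) (norm_nonneg _) ((abs_nonneg _).trans (h j))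

theorem pderiv_sum_mul {p : ℕ} {ι : Type*} [Fintype ι] {f g : ι → Param p → ℝ} {θ : Param p}
    (hf : ∀ i, DifferentiableAt ℝ (f i) θ) (hg : ∀ i, DifferentiableAt ℝ (g i) θ) (j : Fin p) :
    pderiv j (fun y => ∑ i, f i y * g i y) θ =
      ∑ i, pderiv j (f i) θ * g i θ + ∑ i, f i θ * pderiv j (g i) θ := by
  have h : HasFDerivAt (fun y => ∑ i, f i y * g i y)
      (∑ i, (f i θ • fderiv ℝ (g i) θ + g i θ • fderiv ℝ (f i) θ)) θ :=
    HasFDerivAt.fun_sum fun i _ => (hf i).hasFDerivAt.mul (hg i).hasFDerivAt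
  rw [pderiv, h.fderiv, ← Finset.sum_add_distrib]
  simp [pderiv, add_comm, mul_comm]

namespace Game

variable {n m l p q : ℕ} {G : InverseGame.Game n m l p q}

/-! ### The solution map of the linear system -/

/-- The coefficients of the game are differentiable at `θ`. -/
structure DiffAt (G : InverseGame.Game n m l p q) (θ : Param p) (μ : Fin q → ℝ) : Prop where
  R : ∀ v w, DifferentiableAt ℝ (fun θ => G.R θ μ v w) θ
  c : ∀ w, DifferentiableAt ℝ (fun θ => G.c θ μ w) θ
  A : ∀ z w, DifferentiableAt ℝ (fun θ => G.A θ μ z w) θ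
  b : ∀ z, DifferentiableAt ℝ (fun θ => G.rhs θ μ z) θ

variable {θ : Param p} {μ : Fin q → ℝ} {Z : Set (Fin n × Fin l)}

theorem DiffAt.S (h : G.DiffAt θ μ) (Z : Set (Fin n × Fin l))
    (i j : (Fin n × Fin m) ⊕ (Fin n × Fin l)) :
    DifferentiableAt ℝ (fun θ => G.S Z θ μ i j) θ := by
  rcases i with v | z <;> rcases j with w | z'
  · exact h.R v w
  · exact h.A z' v
  · by_cases hz : z ∈ Z
    · simpa [Game.S, hz] using (h.A z w)
    · simp [Game.S, hz]
  · simp [Game.S]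

theorem DiffAt.systemRHS (h : G.DiffAt θ μ) (Z : Set (Fin n × Fin l))
    (i : (Fin n × Fin m) ⊕ (Fin n × Fin l)) :
    DifferentiableAt ℝ (fun θ => G.systemRHS Z θ μ i) θ := by
  rcases i with v | z
  · exact (h.c v).neg
  · by_cases hz : z ∈ Z
    · simpa [Game.systemRHS, hz] using (h.b z)
    · simp [Game.systemRHS, hz]

theorem DiffAt.systemSol (h : G.DiffAt θ μ) (hdet : IsUnit (G.S Z θ μ).det)
    (i : (Fin n × Fin m) ⊕ (Fin n × Fin l)) :
    DifferentiableAt ℝ (fun θ => G.systemSol Z θ μ i) θ := by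
  simp only [Game.systemSol, Matrix.mulVec, dotProduct]
  exact DifferentiableAt.fun_sum fun j _ =>
    (differentiableAt_inv_apply (h.S Z) hdet i j).mul (h.systemRHS Z j)

theorem DiffAt.profileOf (h : G.DiffAt θ μ) (hdet : IsUnit (G.S Z θ μ).det) (w : Fin n × Fin m) :
    DifferentiableAt ℝ (fun θ => G.profileOf Z θ μ w) θ := h.systemSol hdet (Sum.inl w)

theorem DiffAt.dualOf (h : G.DiffAt θ μ) (hdet : IsUnit (G.S Z θ μ).det) (z : Fin n × Fin l) :
    DifferentiableAt ℝ (fun θ => G.dualOf Z θ μ z) θ := h.systemSol hdet (Sum.inr z)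

theorem DiffAt.slack (h : G.DiffAt θ μ) (hdet : IsUnit (G.S Z θ μ).det) (z : Fin n × Fin l) :
    DifferentiableAt ℝ (fun θ => G.rhs θ μ z - (G.A θ μ *ᵥ G.profileOf Z θ μ) z) θ := by
  simp only [Matrix.mulVec, dotProduct]
  exact (h.b z).sub (DifferentiableAt.fun_sum fun w _ => (h.A z w).mul (h.profileOf hdet w))

theorem DiffAt.eventually_isUnit_det (h : G.DiffAt θ μ) (hdet : IsUnit (G.S Z θ μ).det) :
    ∀ᶠ ϑ in nhds θ, IsUnit (G.S Z ϑ μ).det := by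
  filter_upwards [(differentiableAt_det (h.S Z)).continuousAt.eventually_ne hdet.ne_zero]
    with ϑ hϑ using hϑ.isUnit

theorem DiffAt.lossOn (h : G.DiffAt θ μ) (hdet : IsUnit (G.S Z θ μ).det)
    (xbar : Profile n m) : DifferentiableAt ℝ (G.lossOn Z xbar μ) θ := by
  unfold Game.lossOn
  exact DifferentiableAt.fun_sum fun w _ => ((h.profileOf hdet w).sub_const _).pow 2

/-! ### Uniform bounds on the derivatives of the solution -/

/-- The right-hand side of the linear system for the `j`-th partial derivatives of the solution. -/
theorem S_mulVec_pderiv_systemSol (h : G.DiffAt θ μ) (hdet : IsUnit (G.S Z θ μ).det) (j : Fin p)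
    (i : (Fin n × Fin m) ⊕ (Fin n × Fin l)) :
    (G.S Z θ μ *ᵥ fun a => pderiv j (fun ϑ => G.systemSol Z ϑ μ a) θ) i =
      pderiv j (fun ϑ => G.systemRHS Z ϑ μ i) θ -
        ∑ a, pderiv j (fun ϑ => G.S Z ϑ μ i a) θ * G.systemSol Z θ μ a := by
  have h1 : (fun ϑ => G.systemRHS Z ϑ μ i) =ᶠ[nhds θ]
      fun ϑ => ∑ a, G.S Z ϑ μ i a * G.systemSol Z ϑ μ a := by
    filter_upwards [h.eventually_isUnit_det hdet] with ϑ hϑ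
    exact (congrFun (S_mulVec_systemSol hϑ) i).symm
  have h2 : pderiv j (fun ϑ => G.systemRHS Z ϑ μ i) θ =
      pderiv j (fun ϑ => ∑ a, G.S Z ϑ μ i a * G.systemSol Z ϑ μ a) θ := by
    rw [pderiv, pderiv, h1.fderiv_eq]
  rw [h2, pderiv_sum_mul (fun a => h.S Z i a) (fun a => h.systemSol hdet a)]
  simp [Matrix.mulVec, dotProduct]

theorem pderiv_const {j : Fin p} (c : ℝ) : pderiv j (fun _ => c) θ = 0 := by
  simp [pderiv]

theorem pderiv_neg {j : Fin p} (f : Param p → ℝ) : pderiv j (fun ϑ => -f ϑ) θ = -pderiv j f θ := by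
  simp [pderiv, fderiv_fun_neg]

/-- The dual part enters only through its product with the transposed derivative of `A`, so no bound
on the multipliers themselves is needed. -/
theorem abs_S_mulVec_pderiv_systemSol_le (h : G.DiffAt θ μ) (hdet : IsUnit (G.S Z θ μ).det)
    (j : Fin p) {r c b a d M : ℝ} (hr : infNorm (G.dR j θ μ) ≤ r) (hc : ‖G.dc j θ μ‖ ≤ c)
    (hb : ‖G.db j θ μ‖ ≤ b) (ha : infNorm (G.dA j θ μ) ≤ a)
    (hd : ‖(G.dA j θ μ)ᵀ *ᵥ G.dualOf Z θ μ‖ ≤ d) (hM : ‖G.profileOf Z θ μ‖ ≤ M)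
    (i : (Fin n × Fin m) ⊕ (Fin n × Fin l)) :
    |(G.S Z θ μ *ᵥ fun a => pderiv j (fun ϑ => G.systemSol Z ϑ μ a) θ) i| ≤
      c + r * M + d + b + a * M := by
  have hr0 := (infNorm_nonneg _).trans hr
  have ha0 := (infNorm_nonneg _).trans ha
  have hc0 := (norm_nonneg _).trans hc
  have hb0 := (norm_nonneg _).trans hb
  have hd0 := (norm_nonneg _).trans hd
  have hM0 := (norm_nonneg _).trans hM
  have hrM := mul_nonneg hr0 hM0
  have haM := mul_nonneg ha0 hM0
  rw [S_mulVec_pderiv_systemSol h hdet]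
  rcases i with v | z
  · have h1 : pderiv j (fun ϑ => G.systemRHS Z ϑ μ (Sum.inl v)) θ = -G.dc j θ μ v := pderiv_neg _
    have h2 : ∑ a, pderiv j (fun ϑ => G.S Z ϑ μ (Sum.inl v) a) θ * G.systemSol Z θ μ a =
        (G.dR j θ μ *ᵥ G.profileOf Z θ μ) v + ((G.dA j θ μ)ᵀ *ᵥ G.dualOf Z θ μ) v :=
      Fintype.sum_sum_type _
    rw [h1, h2]
    have h3 := (norm_le_pi_norm (G.dc j θ μ) v).trans hc
    have h4 := (norm_le_pi_norm ((G.dA j θ μ)ᵀ *ᵥ G.dualOf Z θ μ) v).trans hd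
    have h5 := (abs_mulVec_le (G.dR j θ μ) (G.profileOf Z θ μ) v).trans
      (mul_le_mul hr hM (norm_nonneg _) hr0)
    rw [Real.norm_eq_abs] at h3 h4
    rw [abs_le] at *
    constructor <;> linarith
  · rw [Fintype.sum_sum_type]
    by_cases hz : z ∈ Z
    · have h1 : pderiv j (fun ϑ => G.systemRHS Z ϑ μ (Sum.inr z)) θ = -G.db j θ μ z := by
        simp only [Game.systemRHS, Sum.elim_inr, hz, if_true]
        exact pderiv_neg _
      have h2 : ∑ w, pderiv j (fun ϑ => G.S Z ϑ μ (Sum.inr z) (Sum.inl w)) θ *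
          G.systemSol Z θ μ (Sum.inl w) = -(G.dA j θ μ *ᵥ G.profileOf Z θ μ) z := by
        simp only [Game.S, Matrix.fromBlocks_apply₂₁, Matrix.of_apply, hz, if_true, Matrix.mulVec,
          dotProduct, pderiv_neg, neg_mul, Finset.sum_neg_distrib]
        rfl
      have h3 : ∑ z', pderiv j (fun ϑ => G.S Z ϑ μ (Sum.inr z) (Sum.inr z')) θ *
          G.systemSol Z θ μ (Sum.inr z') = 0 := by
        simp [Game.S, pderiv_const]
      rw [h1, h2, h3]
      have h4 := (norm_le_pi_norm (G.db j θ μ) z).trans hb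
      have h5 := (abs_mulVec_le (G.dA j θ μ) (G.profileOf Z θ μ) z).trans
        (mul_le_mul ha hM (norm_nonneg _) ha0)
      rw [Real.norm_eq_abs] at h4
      rw [abs_le] at *
      constructor <;> linarith
    · simp only [Game.systemRHS, Sum.elim_inr, hz, if_false, Game.S, Matrix.fromBlocks_apply₂₁,
        Matrix.fromBlocks_apply₂₂, Matrix.of_apply, pderiv_const, zero_mul, Finset.sum_const_zero,
        add_zero, sub_zero, abs_zero]
      linarith

theorem abs_pderiv_systemSol_le (hdet : IsUnit (G.S Z θ μ).det) (j : Fin p) {L₀ B : ℝ}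
    (hL : ∀ i a, |(G.S Z θ μ)⁻¹ i a| ≤ L₀)
    (hB : ∀ i, |(G.S Z θ μ *ᵥ fun a => pderiv j (fun ϑ => G.systemSol Z ϑ μ a) θ) i| ≤ B)
    (i : (Fin n × Fin m) ⊕ (Fin n × Fin l)) :
    |pderiv j (fun ϑ => G.systemSol Z ϑ μ i) θ| ≤
      ∑ _a : (Fin n × Fin m) ⊕ (Fin n × Fin l), L₀ * B := by
  set v := fun a => pderiv j (fun ϑ => G.systemSol Z ϑ μ a) θ with hv
  have h1 : v = (G.S Z θ μ)⁻¹ *ᵥ (G.S Z θ μ *ᵥ v) := by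
    rw [Matrix.mulVec_mulVec, Matrix.nonsing_inv_mul _ hdet, Matrix.one_mulVec]
  change |v i| ≤ _
  rw [h1]
  refine (Finset.abs_sum_le_sum_abs _ _).trans (Finset.sum_le_sum fun a _ => ?_)
  rw [abs_mul]
  exact mul_le_mul (hL i a) (hB a) (abs_nonneg _) ((abs_nonneg _).trans (hL i a))

theorem norm_fderiv_lossOn_le (h : G.DiffAt θ μ) (hdet : IsUnit (G.S Z θ μ).det)
    (xbar : Profile n m) {M D : ℝ} (hM : ‖G.profileOf Z θ μ‖ ≤ M)
    (hD : ∀ j i, |pderiv j (fun ϑ => G.systemSol Z ϑ μ i) θ| ≤ D) :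
    ‖fderiv ℝ (G.lossOn Z xbar μ) θ‖ ≤
      ∑ _j : Fin p, ∑ _w : Fin n × Fin m, 2 * ((M + ‖xbar‖) * D) := by
  refine norm_le_of_pderiv_bound fun j => ?_
  have h1 : ∀ w, DifferentiableAt ℝ (fun ϑ => G.profileOf Z ϑ μ w - xbar w) θ :=
    fun w => (h.profileOf hdet w).sub_const _
  have h2 : G.lossOn Z xbar μ = fun ϑ => ∑ w, (G.profileOf Z ϑ μ w - xbar w) *
      (G.profileOf Z ϑ μ w - xbar w) := by
    ext ϑ
    simp only [lossOn, sq]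
  have h3 : ∀ w, pderiv j (fun ϑ => G.profileOf Z ϑ μ w - xbar w) θ =
      pderiv j (fun ϑ => G.systemSol Z ϑ μ (Sum.inl w)) θ := fun w => by
    rw [pderiv, fderiv_sub_const]
    rfl
  change |pderiv j (G.lossOn Z xbar μ) θ| ≤ _
  rw [h2, pderiv_sum_mul h1 h1, ← Finset.sum_add_distrib]
  refine (Finset.abs_sum_le_sum_abs _ _).trans (Finset.sum_le_sum fun w _ => ?_)
  rw [h3, mul_comm (pderiv _ _ _), ← two_mul, abs_mul, abs_two, abs_mul]
  have h4 : |G.profileOf Z θ μ w - xbar w| ≤ M + ‖xbar‖ :=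
    (abs_sub _ _).trans (add_le_add ((norm_le_pi_norm _ w).trans hM) (norm_le_pi_norm xbar w))
  exact mul_le_mul_of_nonneg_left
    (mul_le_mul h4 (hD j _) (abs_nonneg _) ((abs_nonneg _).trans h4)) zero_le_two

end InverseGame.Game

/-! ### Lipschitz continuity from pointwise increment bounds -/

namespace InverseGame

/-- A function that is calm with a uniform constant at every point of a convex set is Lipschitz
there. -/
theorem lipschitzOnWith_of_calm {E : Type*} [NormedAddCommGroup E] [NormedSpace ℝ E] {s : Set E}
    (hs : Convex ℝ s) {f : E → ℝ} {C : NNReal}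
    (h : ∀ x ∈ s, ∀ᶠ y in nhds x, |f y - f x| ≤ C * ‖y - x‖) : LipschitzOnWith C f s := by
  refine LipschitzOnWith.of_dist_le_mul fun y hy x hx => ?_
  rw [dist_eq_norm, dist_eq_norm]
  have hmem : ∀ t ∈ Icc (0 : ℝ) 1, x + t • (y - x) ∈ s := fun t ht =>
    hs.add_smul_sub_mem hx hy ht
  set φ : ℝ → ℝ := fun t => f (x + t • (y - x)) - f x with hφ
  have hcalm : ∀ t ∈ Icc (0 : ℝ) 1, ∀ᶠ r in nhds t, |φ r - φ t| ≤ C * ‖y - x‖ * |r - t| := by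
    intro t ht
    have hc : Filter.Tendsto (fun r : ℝ => x + r • (y - x)) (nhds t) (nhds (x + t • (y - x))) :=
      (by fun_prop : Continuous fun r : ℝ => x + r • (y - x)).tendsto t
    filter_upwards [hc.eventually (h _ (hmem t ht))] with r hr
    have h1 : x + r • (y - x) - (x + t • (y - x)) = (r - t) • (y - x) := by
      rw [sub_smul]
      abel
    rw [h1, norm_smul, Real.norm_eq_abs] at hr
    simp only [hφ, sub_sub_sub_cancel_right]
    linarith
  have hcont : ContinuousOn φ (Icc 0 1) := by
    intro t ht
    refine ContinuousAt.continuousWithinAt ?_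
    rw [ContinuousAt, tendsto_iff_norm_sub_tendsto_zero]
    refine squeeze_zero' (Filter.Eventually.of_forall fun _ => norm_nonneg _) (hcalm t ht) ?_
    have : Continuous fun r : ℝ => C * ‖y - x‖ * |r - t| := by fun_prop
    simpa using this.tendsto t
  -- The comparison principle for right slopes requires a strict inequality between the slope bound
  -- and the derivative of the barrier, hence the margin `δ`.
  have hbound : ∀ δ > (0 : ℝ), ‖φ 1‖ ≤ (C * ‖y - x‖ + δ) * 1 := by
    intro δ hδ
    refine image_norm_le_of_liminf_right_slope_norm_lt_deriv_boundary (f := φ)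
      (f' := fun _ => C * ‖y - x‖) (B := fun t => (C * ‖y - x‖ + δ) * t)
      (B' := fun _ => C * ‖y - x‖ + δ) hcont ?_ ?_ (by fun_prop) ?_ ?_
      (right_mem_Icc.2 zero_le_one)
    · intro t ht r hr
      refine Filter.Eventually.frequently ?_
      filter_upwards [(hcalm t (Ico_subset_Icc_self ht)).filter_mono nhdsWithin_le_nhds,
        self_mem_nhdsWithin] with z hz hzt
      have h0 : 0 < z - t := sub_pos.2 hzt
      refine lt_of_le_of_lt ?_ hr
      rw [slope_def_field, div_le_iff₀ h0]
      rw [abs_of_pos h0] at hz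
      exact (le_abs_self _).trans ((abs_norm_sub_norm_le _ _).trans hz)
    · simp [hφ]
    · intro t _
      simpa using ((hasDerivAt_id t).const_mul (C * ‖y - x‖ + δ)).hasDerivWithinAt
    · intro t _ _
      linarith
  have h1 : ‖φ 1‖ ≤ C * ‖y - x‖ := le_of_forall_pos_le_add fun δ hδ => by
    simpa using hbound δ hδ
  simpa [hφ] using h1

namespace Game

variable {n m l p q K : ℕ} {G : InverseGame.Game n m l p q}
  {Θ : Set (Param p)} {μ : Fin K → Fin q → ℝ} {θ : Param p}

/-! ### The equilibrium as a function of the parameters -/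

theorem Regular.diffAt (hG : G.Regular Θ μ) (hΘ : IsOpen Θ) (hθ : θ ∈ Θ) (k : Fin K) :
    G.DiffAt θ (μ k) := by
  have h : ∀ {f : Param p → ℝ}, ContDiffOn ℝ 1 f Θ → DifferentiableAt ℝ f θ := fun hf =>
    (hf.contDiffAt (hΘ.mem_nhds hθ)).differentiableAt one_ne_zero
  exact ⟨fun v w => h (hG.contDiff_R k v w), fun w => h (hG.contDiff_c k w),
    fun z w => h (hG.contDiff_A k z w), fun z => h (hG.contDiff_b k z)⟩

theorem continuous_potential (θ : Param p) (μ : Fin q → ℝ) : Continuous (G.potential θ μ) := by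
  unfold potential
  fun_prop

theorem isClosed_feasibleSet (θ : Param p) (μ : Fin q → ℝ) : IsClosed (G.feasibleSet θ μ) :=
  isClosed_le (by fun_prop) continuous_const

theorem exists_isPotentialMin (hG : G.Regular Θ μ) (hCQ : G.ConstraintQualifications Θ μ)
    (hθ : θ ∈ Θ) (k : Fin K) : ∃ x, G.IsPotentialMin θ (μ k) x := by
  obtain ⟨M, hM⟩ := hCQ.bounded
  have hc : IsCompact (G.feasibleSet θ (μ k)) := by
    refine Metric.isCompact_of_isClosed_isBounded (isClosed_feasibleSet θ (μ k)) ?_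
    exact (Metric.isBounded_closedBall (x := 0) (r := M)).subset fun x hx =>
      mem_closedBall_zero_iff.2 (hM θ hθ k x hx)
  obtain ⟨x, hx, hmin⟩ := hc.exists_isMinOn (hG.nonempty θ hθ k)
    (continuous_potential θ (μ k)).continuousOn
  exact ⟨x, hx, fun y hy => hmin hy⟩

theorem WellBehavedDerivatives.isUnit_det (hWD : G.WellBehavedDerivatives Θ μ) (hθ : θ ∈ Θ)
    (k : Fin K) {Z : Set (Fin n × Fin l)} (hZ : G.IsActiveSet θ (μ k) Z) :
    IsUnit (G.S Z θ (μ k)).det := by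
  obtain ⟨L₀, -, h⟩ := hWD.inverse_bounded
  exact (h θ hθ k Z hZ).1

theorem existsUnique_isNash (hG : G.Regular Θ μ) (hCQ : G.ConstraintQualifications Θ μ)
    (hWD : G.WellBehavedDerivatives Θ μ) (hθ : θ ∈ Θ) (k : Fin K) :
    ∃! x, G.IsNash θ (μ k) x := by
  obtain ⟨hR, hN⟩ := hG.isPotential θ hθ k
  obtain ⟨x, hx⟩ := exists_isPotentialMin hG hCQ hθ k
  exact ⟨x, (hN x).2 hx, fun y hy => IsPotentialMin.unique hR
    (fun Z hZ => hWD.isUnit_det hθ k hZ) ((hN y).1 hy) hx⟩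

theorem isPotentialMin_equilibrium (hG : G.Regular Θ μ) (hCQ : G.ConstraintQualifications Θ μ)
    (hWD : G.WellBehavedDerivatives Θ μ) (hθ : θ ∈ Θ) (k : Fin K) :
    G.IsPotentialMin θ (μ k) (G.equilibrium θ (μ k)) :=
  ((hG.isPotential θ hθ k).2 _).1
    (Classical.epsilon_spec (existsUnique_isNash hG hCQ hWD hθ k).exists)

theorem IsPotentialMin.eq_equilibrium (hG : G.Regular Θ μ)
    (hCQ : G.ConstraintQualifications Θ μ) (hWD : G.WellBehavedDerivatives Θ μ) (hθ : θ ∈ Θ)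
    {k : Fin K} {x : Profile n m} (hx : G.IsPotentialMin θ (μ k) x) :
    x = G.equilibrium θ (μ k) :=
  hx.unique (hG.isPotential θ hθ k).1 (fun _ hZ => hWD.isUnit_det hθ k hZ)
    (isPotentialMin_equilibrium hG hCQ hWD hθ k)

theorem isActiveSet_activeSet (hG : G.Regular Θ μ) (hCQ : G.ConstraintQualifications Θ μ)
    (hWD : G.WellBehavedDerivatives Θ μ) (hθ : θ ∈ Θ) (k : Fin K) :
    G.IsActiveSet θ (μ k) (G.activeSet θ (μ k)) :=
  ⟨_, (isPotentialMin_equilibrium hG hCQ hWD hθ k).1, rfl⟩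

theorem isKKT_multiplier (hG : G.Regular Θ μ) (hCQ : G.ConstraintQualifications Θ μ)
    (hWD : G.WellBehavedDerivatives Θ μ) (hθ : θ ∈ Θ) (k : Fin K) :
    G.IsKKT θ (μ k) (G.equilibrium θ (μ k)) (G.multiplier θ (μ k)) :=
  Classical.epsilon_spec (p := fun lam => G.IsKKT θ (μ k) (G.equilibrium θ (μ k)) lam)
    ⟨_, ((isPotentialMin_equilibrium hG hCQ hWD hθ k).isKKT (hG.isPotential θ hθ k).1
      (hWD.isUnit_det hθ k (isActiveSet_activeSet hG hCQ hWD hθ k))).2⟩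

/-- Uniqueness of the minimizer settles the primal part. Both multipliers vanish off the active set,
so both pairs solve the same invertible system. -/
theorem IsKKT.eq_equilibrium (hG : G.Regular Θ μ) (hCQ : G.ConstraintQualifications Θ μ)
    (hWD : G.WellBehavedDerivatives Θ μ) (hθ : θ ∈ Θ) {k : Fin K} {x : Profile n m}
    {lam : Dual n l} (h : G.IsKKT θ (μ k) x lam) :
    x = G.equilibrium θ (μ k) ∧ lam = G.multiplier θ (μ k) := by
  obtain rfl := (h.isPotentialMin (hG.isPotential θ hθ k).1).eq_equilibrium hG hCQ hWD hθ
  have hu := hWD.isUnit_det hθ k (isActiveSet_activeSet hG hCQ hWD hθ k)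
  have h' := isKKT_multiplier hG hCQ hWD hθ k
  have h1 := (h.elim_eq_systemSol hu Subset.rfl fun z hz => h.eq_zero_of_notMem hz).trans
    (h'.elim_eq_systemSol hu Subset.rfl fun z hz => h'.eq_zero_of_notMem hz).symm
  exact ⟨rfl, funext fun z => congrFun h1 (Sum.inr z)⟩

theorem profileOf_dualOf_activeSet (hG : G.Regular Θ μ) (hCQ : G.ConstraintQualifications Θ μ)
    (hWD : G.WellBehavedDerivatives Θ μ) (hθ : θ ∈ Θ) (k : Fin K) :
    G.profileOf (G.activeSet θ (μ k)) θ (μ k) = G.equilibrium θ (μ k) ∧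
      G.dualOf (G.activeSet θ (μ k)) θ (μ k) = G.multiplier θ (μ k) := by
  have h := (isPotentialMin_equilibrium hG hCQ hWD hθ k).isKKT (hG.isPotential θ hθ k).1
      (hWD.isUnit_det hθ k (isActiveSet_activeSet hG hCQ hWD hθ k))
  exact ⟨h.1, (h.2.eq_equilibrium hG hCQ hWD hθ).2⟩

/-- At parameters without degenerate constraints the loss is locally the loss for the fixed
active set, hence differentiable. -/
theorem hasGradientAt_loss (hG : G.Regular Θ μ) (hCQ : G.ConstraintQualifications Θ μ)
    (hWD : G.WellBehavedDerivatives Θ μ) (hΘ : IsOpen Θ) (hθ : θ ∈ Θ) (k : Fin K)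
    (hnd : G.activeSet θ (μ k) ∩ G.zeroDualSet θ (μ k) = ∅) (xbar : Profile n m) :
    HasGradientAt (G.loss xbar (μ k)) (G.lossGrad xbar (μ k) θ) θ := by
  set Z := G.activeSet θ (μ k) with hZ
  have hu : IsUnit (G.S Z θ (μ k)).det :=
    hWD.isUnit_det hθ k (isActiveSet_activeSet hG hCQ hWD hθ k)
  have hd := hG.diffAt hΘ hθ k
  obtain ⟨hx, hlam⟩ := profileOf_dualOf_activeSet hG hCQ hWD hθ k
  rw [← hZ] at hx hlam
  have hKKT := isKKT_multiplier hG hCQ hWD hθ k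
  -- At `θ` the multipliers on `Z` are positive by nondegeneracy, and the slacks off `Z` are
  -- positive by definition of `Z`. These strict inequalities persist nearby, where the solution for
  -- the fixed set `Z` is therefore still a KKT pair.
  have hdual : ∀ z ∈ Z, ∀ᶠ ϑ in nhds θ, 0 < G.dualOf Z ϑ (μ k) z := by
    intro z hz
    refine (hd.dualOf hu z).continuousAt.eventually (lt_mem_nhds ?_)
    beta_reduce
    rw [hlam]
    refine lt_of_le_of_ne (hKKT.2.2.1 z) fun h0 => ?_
    have : z ∈ Z ∩ G.zeroDualSet θ (μ k) := ⟨hz, h0.symm⟩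
    rw [hnd] at this
    exact this
  have hslack : ∀ z ∉ Z, ∀ᶠ ϑ in nhds θ,
      0 < G.rhs ϑ (μ k) z - (G.A ϑ (μ k) *ᵥ G.profileOf Z ϑ (μ k)) z := by
    intro z hz
    refine (hd.slack hu z).continuousAt.eventually (lt_mem_nhds ?_)
    beta_reduce
    rw [hx]
    exact lt_of_le_of_ne (sub_nonneg.2 (hKKT.2.1 z)) fun h0 => hz h0.symm
  have hloc : G.loss xbar (μ k) =ᶠ[nhds θ] G.lossOn Z xbar (μ k) := by
    filter_upwards [hd.eventually_isUnit_det hu, hΘ.mem_nhds hθ,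
      Filter.eventually_all.2 fun z => Filter.eventually_imp_distrib_left.2 (hdual z),
      Filter.eventually_all.2 fun z => Filter.eventually_imp_distrib_left.2 (hslack z)]
      with ϑ h1 h2 h3 h4
    have h5 : G.IsKKT ϑ (μ k) (G.profileOf Z ϑ (μ k)) (G.dualOf Z ϑ (μ k)) := by
      refine isKKT_of_feasible h1 (fun z => ?_) fun z => ?_
      · by_cases hz : z ∈ Z
        · exact (A_mulVec_profileOf h1 hz).le
        · exact (sub_pos.1 (h4 z hz)).le
      · by_cases hz : z ∈ Z
        · exact (h3 z hz).le
        · exact (dualOf_eq_zero h1 hz).ge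
    rw [loss, lossOn, (h5.eq_equilibrium hG hCQ hWD h2).1]
  exact (hd.lossOn hu xbar).hasGradientAt.congr_of_eventuallyEq hloc

/-- An active set that recurs arbitrarily close to `θ` also determines the equilibrium and its
multiplier at `θ`. -/
theorem eq_of_frequently_activeSet (hG : G.Regular Θ μ)
    (hCQ : G.ConstraintQualifications Θ μ) (hWD : G.WellBehavedDerivatives Θ μ) (hΘ : IsOpen Θ)
    (hθ : θ ∈ Θ) (k : Fin K) {L₀ : ℝ} (hL : ∀ θ ∈ Θ, ∀ k, ∀ Z, G.IsActiveSet θ (μ k) Z →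
      IsUnit (G.S Z θ (μ k)).det ∧ infNorm ((G.S Z θ (μ k))⁻¹)ᵀ < L₀)
    {Z : Set (Fin n × Fin l)} (hZ : ∃ᶠ ϑ in nhds θ, G.activeSet ϑ (μ k) = Z) :
    IsUnit (G.S Z θ (μ k)).det ∧ (∀ i a, |(G.S Z θ (μ k))⁻¹ i a| ≤ L₀) ∧
      G.profileOf Z θ (μ k) = G.equilibrium θ (μ k) ∧
      G.dualOf Z θ (μ k) = G.multiplier θ (μ k) := by
  have hd := hG.diffAt hΘ hθ k
  have hfr : ∃ᶠ ϑ in nhds θ, G.activeSet ϑ (μ k) = Z ∧ ϑ ∈ Θ :=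
    hZ.and_eventually (hΘ.mem_nhds hθ)
  have hprop : ∀ ϑ, G.activeSet ϑ (μ k) = Z ∧ ϑ ∈ Θ → IsUnit (G.S Z ϑ (μ k)).det ∧
      (∀ i a, |(G.S Z ϑ (μ k))⁻¹ i a| ≤ L₀) ∧
      G.profileOf Z ϑ (μ k) = G.equilibrium ϑ (μ k) ∧
      G.dualOf Z ϑ (μ k) = G.multiplier ϑ (μ k) := by
    rintro ϑ ⟨rfl, hϑ⟩
    obtain ⟨h1, h2⟩ := hL ϑ hϑ k _ (isActiveSet_activeSet hG hCQ hWD hϑ k)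
    exact ⟨h1, fun i a => (abs_apply_le_infNorm ((G.S _ ϑ (μ k))⁻¹)ᵀ a i).trans h2.le,
      profileOf_dualOf_activeSet hG hCQ hWD hϑ k⟩
  -- `Z` need not be an active set at `θ` itself, so invertibility has to come from nearby
  -- parameters. There the entries of the inverse are at most `L₀`, so its determinant is at most
  -- `N! * L₀ ^ N` and that of `S` stays away from zero, which is a closed condition.
  have hu : IsUnit (G.S Z θ (μ k)).det := by
    set N := Fintype.card ((Fin n × Fin m) ⊕ (Fin n × Fin l))
    have hmem : (G.S Z θ (μ k)).det ∈ {y : ℝ | 1 ≤ (N.factorial • L₀ ^ N) * |y|} := by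
      refine IsClosed.mem_of_frequently_of_tendsto (isClosed_le (by fun_prop) (by fun_prop)) ?_
        (differentiableAt_det (hd.S Z)).continuousAt
      refine hfr.mono fun ϑ hϑ => ?_
      obtain ⟨h1, h2, -⟩ := hprop ϑ hϑ
      have h3 := Matrix.det_le (abv := AbsoluteValue.abs) (A := (G.S Z ϑ (μ k))⁻¹) (x := L₀) h2
      have h4 : (G.S Z ϑ (μ k))⁻¹.det * (G.S Z ϑ (μ k)).det = 1 := by
        rw [← Matrix.det_mul, Matrix.nonsing_inv_mul _ h1, Matrix.det_one]
      calc (1 : ℝ) = |(G.S Z ϑ (μ k))⁻¹.det| * |(G.S Z ϑ (μ k)).det| := by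
            rw [← abs_mul, h4, abs_one]
        _ ≤ _ := mul_le_mul_of_nonneg_right h3 (abs_nonneg _)
    refine isUnit_iff_ne_zero.2 fun h0 => ?_
    rw [h0] at hmem
    norm_num at hmem
  -- Primal and dual feasibility are closed conditions that hold at parameters arbitrarily close to
  -- `θ`, and the solution of the system is continuous at `θ`.
  have hKKT : G.IsKKT θ (μ k) (G.profileOf Z θ (μ k)) (G.dualOf Z θ (μ k)) := by
    refine isKKT_of_feasible hu (fun z => ?_) fun z => ?_
    · have : G.rhs θ (μ k) z - (G.A θ (μ k) *ᵥ G.profileOf Z θ (μ k)) z ∈ Ici (0 : ℝ) := by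
        refine isClosed_Ici.mem_of_frequently_of_tendsto ?_ (hd.slack hu z).continuousAt
        refine hfr.mono fun ϑ hϑ => ?_
        rw [(hprop ϑ hϑ).2.2.1]
        exact sub_nonneg.2 ((isPotentialMin_equilibrium hG hCQ hWD hϑ.2 k).1 z)
      exact sub_nonneg.1 this
    · have : G.dualOf Z θ (μ k) z ∈ Ici (0 : ℝ) := by
        refine isClosed_Ici.mem_of_frequently_of_tendsto ?_ (hd.dualOf hu z).continuousAt
        refine hfr.mono fun ϑ hϑ => ?_
        rw [(hprop ϑ hϑ).2.2.2]
        exact (isKKT_multiplier hG hCQ hWD hϑ.2 k).2.2.1 z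
      exact this
  refine ⟨hu, fun i a => ?_, hKKT.eq_equilibrium hG hCQ hWD hθ⟩
  have : (G.S Z θ (μ k))⁻¹ i a ∈ {y : ℝ | |y| ≤ L₀} :=
    IsClosed.mem_of_frequently_of_tendsto (isClosed_le (by fun_prop) (by fun_prop))
      (hfr.mono fun ϑ hϑ => (hprop ϑ hϑ).2.1 i a)
      (differentiableAt_inv_apply (hd.S Z) hu i a).continuousAt
  exact this

/-- The loss of one data point is Lipschitz on the parameter set. -/
theorem exists_lipschitzOnWith_loss (hG : G.Regular Θ μ) (hCQ : G.ConstraintQualifications Θ μ)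
    (hWD : G.WellBehavedDerivatives Θ μ) (hΘ : IsOpen Θ) (hΘc : Convex ℝ Θ) (k : Fin K)
    (xbar : Profile n m) : ∃ C, LipschitzOnWith C (G.loss xbar (μ k)) Θ := by
  obtain ⟨L₀, hL₀, hL⟩ := hWD.inverse_bounded
  obtain ⟨M, hM⟩ := hCQ.bounded
  obtain ⟨r, -, hr⟩ := hWD.dR_bounded
  obtain ⟨c, hc⟩ := hWD.dc_bounded
  obtain ⟨b, hb⟩ := hWD.db_bounded
  obtain ⟨a, ha⟩ := hWD.dA_bounded
  obtain ⟨d, hdm⟩ := hWD.dA_multiplier_bounded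
  set D : ℝ := ∑ _a : (Fin n × Fin m) ⊕ (Fin n × Fin l), L₀ * (c + r * M + d + b + a * M)
  set C : ℝ := ∑ _j : Fin p, ∑ _w : Fin n × Fin m, 2 * ((M + ‖xbar‖) * D)
  have hbound : ∀ θ ∈ Θ, ∀ Z, (∃ᶠ ϑ in nhds θ, G.activeSet ϑ (μ k) = Z) →
      DifferentiableAt ℝ (G.lossOn Z xbar (μ k)) θ ∧
      ‖fderiv ℝ (G.lossOn Z xbar (μ k)) θ‖ ≤ C ∧
      G.lossOn Z xbar (μ k) θ = G.loss xbar (μ k) θ := by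
    intro θ hθ Z hZ
    obtain ⟨hu, hinv, hx, hlam⟩ := eq_of_frequently_activeSet hG hCQ hWD hΘ hθ k hL hZ
    have hd := hG.diffAt hΘ hθ k
    have hxM : ‖G.profileOf Z θ (μ k)‖ ≤ M := by
      rw [hx]
      exact hM θ hθ k _ (isPotentialMin_equilibrium hG hCQ hWD hθ k).1
    refine ⟨hd.lossOn hu xbar, norm_fderiv_lossOn_le hd hu xbar hxM fun j i => ?_, ?_⟩
    · refine abs_pderiv_systemSol_le hu j hinv (fun i => ?_) i
      refine abs_S_mulVec_pderiv_systemSol_le hd hu j (hr k θ hθ j) (hc k θ hθ j) (hb k θ hθ j)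
        (ha k θ hθ j) ?_ hxM i
      rw [hlam]
      exact hdm k θ hθ j
    · rw [lossOn, loss, hx]
  -- `C` bounds the derivatives of all branches; the additional `1` absorbs the remainder of the
  -- first-order expansion.
  refine ⟨(C + 1).toNNReal, lipschitzOnWith_of_calm hΘc fun θ hθ => ?_⟩
  have hC : C < ((C + 1).toNNReal : ℝ) := (lt_add_one C).trans_le (Real.le_coe_toNNReal _)
  -- Near `θ` the parameters are sorted by their active set. A recurring set gives a smooth branch
  -- that agrees with the loss both at `θ` and at `ϑ`; any other set does not occur close to `θ`.
  -- Finitely many sets allow a common neighborhood.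
  have hcalm : ∀ Z, ∀ᶠ ϑ in nhds θ, G.activeSet ϑ (μ k) = Z →
      |G.loss xbar (μ k) ϑ - G.loss xbar (μ k) θ| ≤ (C + 1).toNNReal * ‖ϑ - θ‖ := by
    intro Z
    by_cases hZ : ∃ᶠ ϑ in nhds θ, G.activeSet ϑ (μ k) = Z
    · obtain ⟨h1, h2, h3⟩ := hbound θ hθ Z hZ
      have h4 := h1.hasFDerivAt.isLittleO.def (sub_pos.2 hC)
      filter_upwards [h4, hΘ.mem_nhds hθ] with ϑ h5 hϑ hZϑ
      have h6 : G.lossOn Z xbar (μ k) ϑ = G.loss xbar (μ k) ϑ := by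
        rw [← hZϑ, lossOn, loss, (profileOf_dualOf_activeSet hG hCQ hWD hϑ k).1]
      rw [h6, h3] at h5
      have h7 := ((fderiv ℝ (G.lossOn Z xbar (μ k)) θ).le_opNorm (ϑ - θ)).trans
        (mul_le_mul_of_nonneg_right h2 (norm_nonneg _))
      have h8 := norm_add_le (G.loss xbar (μ k) ϑ - G.loss xbar (μ k) θ -
        (fderiv ℝ (G.lossOn Z xbar (μ k)) θ) (ϑ - θ)) ((fderiv ℝ (G.lossOn Z xbar (μ k)) θ) (ϑ - θ))
      rw [sub_add_cancel, Real.norm_eq_abs] at h8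
      linarith
    · filter_upwards [Filter.not_frequently.1 hZ] with ϑ h1 h2 using absurd h2 h1
  filter_upwards [Filter.eventually_all.2 hcalm] with ϑ hϑ using hϑ _ rfl

end InverseGame.Game

namespace InverseGame

/-! ### Averages over balls -/

section Average

set_option linter.unusedSectionVars false

variable {E : Type*} [NormedAddCommGroup E] [InnerProductSpace ℝ E] [FiniteDimensional ℝ E]
  [CompleteSpace E] [MeasurableSpace E] [BorelSpace E] {ν : Measure E} [ν.IsAddHaarMeasure]
  {Θ : Set E} {ε : ℝ}

variable (ν ε) in
/-- The uniform distribution on the ball of radius `ε` around `0`. -/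
noncomputable def ballMeasure : Measure E :=
  ProbabilityTheory.cond ν (Metric.ball 0 ε)

theorem isProbabilityMeasure_ballMeasure (hε : 0 < ε) : IsProbabilityMeasure (ballMeasure ν ε) :=
  ProbabilityTheory.cond_isProbabilityMeasure_of_finite (Metric.measure_ball_pos ν 0 hε).ne'
    measure_ball_lt_top.ne

/-- Translation invariance moves the center from the domain into the integrand, so that the average
can be differentiated under a fixed probability measure. -/
theorem setAverage_ball_eq (f : E → E) (v : E) :
    ⨍ u in Metric.ball v ε, f u ∂ν = ∫ u, f (v + u) ∂ballMeasure ν ε := by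
  have h := (measurePreserving_add_left ν v).setIntegral_preimage_emb
    (measurableEmbedding_addLeft v) f (Metric.ball v ε)
  rw [preimage_add_ball, sub_self] at h
  rw [setAverage_eq, Measure.addHaar_real_ball_center, ← h, ballMeasure, ProbabilityTheory.cond,
    integral_smul_measure, ENNReal.toReal_inv, Measure.real]

theorem ae_ball_of_ae {P : E → Prop} (h : ∀ᵐ x ∂ν.restrict Θ, P x) (hΘ : IsOpen Θ) {v : E}
    (hv : Metric.ball v ε ⊆ Θ) : ∀ᵐ u ∂ν.restrict (Metric.ball 0 ε), P (v + u) := by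
  rw [ae_restrict_iff' hΘ.measurableSet] at h
  rw [ae_restrict_iff' measurableSet_ball]
  filter_upwards [(measurePreserving_add_left ν v).quasiMeasurePreserving.ae h] with u hu hu0
  exact hu (hv (by simpa [Metric.mem_ball, dist_eq_norm] using hu0))

/-- A compact ball inside an open set has a thickening inside that set. -/
theorem exists_ball_add_mem (hΘ : IsOpen Θ) {v : E} (hv : Metric.closedBall v ε ⊆ Θ) :
    ∃ δ > 0, ∀ w ∈ Metric.ball v δ, ∀ u ∈ Metric.closedBall (0 : E) ε, w + u ∈ Θ := by
  obtain ⟨δ, hδ, h⟩ := (isCompact_closedBall v ε).exists_thickening_subset_open hΘ hv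
  refine ⟨δ, hδ, fun w hw u hu => h (Metric.mem_thickening_iff.2 ⟨v + u, ?_, ?_⟩)⟩
  · simpa [dist_eq_norm] using hu
  · simpa using hw

theorem isOpen_setOf_closedBall_subset (hΘ : IsOpen Θ) :
    IsOpen {v : E | Metric.closedBall v ε ⊆ Θ} := by
  refine Metric.isOpen_iff.2 fun v hv => ?_
  obtain ⟨δ, hδ, h⟩ := exists_ball_add_mem hΘ hv
  refine ⟨δ, hδ, fun w hw x hx => ?_⟩
  have := h w hw (x - w) (by simpa [dist_eq_norm] using hx)
  rwa [add_sub_cancel] at this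

theorem convex_setOf_closedBall_subset (hΘ : Convex ℝ Θ) :
    Convex ℝ {v : E | Metric.closedBall v ε ⊆ Θ} := by
  intro v hv w hw a b ha hb hab x hx
  have h1 : ∀ y : E, y + (x - (a • v + b • w)) ∈ Metric.closedBall y ε := fun y => by
    simpa [dist_eq_norm] using hx
  have h2 := hΘ (hv (h1 v)) (hw (h1 w)) ha hb hab
  rw [smul_add, smul_add, add_add_add_comm, ← add_smul, hab, one_smul, add_sub_cancel] at h2
  exact h2

/-- The gradient of a Lipschitz function, extended by zero outside `Θ`. -/
noncomputable def gradientOn (Θ : Set E) (f : E → ℝ) : E → E := Θ.indicator (gradient f)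

theorem measurable_gradientOn (hΘ : IsOpen Θ) (f : E → ℝ) : Measurable (gradientOn Θ f) := by
  refine Measurable.indicator ?_ hΘ.measurableSet
  exact (InnerProductSpace.toDual ℝ E).symm.continuous.measurable.comp (measurable_fderiv ℝ f)

theorem norm_gradientOn_le (hΘ : IsOpen Θ) {f : E → ℝ} {C : NNReal} (hf : LipschitzOnWith C f Θ)
    (x : E) : ‖gradientOn Θ f x‖ ≤ C := by
  by_cases hx : x ∈ Θ
  · rw [gradientOn, indicator_of_mem hx, gradient, LinearIsometryEquiv.norm_map]
    exact norm_fderiv_le_of_lipschitzOn ℝ (hΘ.mem_nhds hx) hf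
  · simp [gradientOn, hx]

theorem ae_eq_gradientOn (hΘ : IsOpen Θ) {ℓ : E → ℝ} {f : E → E}
    (h : ∀ᵐ x ∂ν.restrict Θ, HasGradientAt ℓ (f x) x) : f =ᵐ[ν.restrict Θ] gradientOn Θ ℓ := by
  filter_upwards [h, ae_restrict_mem hΘ.measurableSet] with x hx hxΘ
  rw [gradientOn, indicator_of_mem hxΘ, hx.gradient]

/-- Differentiation under the integral needs the integrand to be differentiable only at the one
point `v`, for almost every `u`; the Lipschitz constant serves as dominating function. -/
theorem hasGradientAt_average (hΘ : IsOpen Θ) (hε : 0 < ε) {ℓ : E → ℝ} {C : NNReal}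
    (hℓ : LipschitzOnWith C ℓ Θ) (hf : ∀ᵐ x ∂ν.restrict Θ, HasGradientAt ℓ (gradientOn Θ ℓ x) x)
    {v : E} (hv : Metric.closedBall v ε ⊆ Θ) :
    HasGradientAt (fun w => ∫ u, ℓ (w + u) ∂ballMeasure ν ε)
      (∫ u, gradientOn Θ ℓ (v + u) ∂ballMeasure ν ε) v := by
  have := isProbabilityMeasure_ballMeasure (ν := ν) hε
  obtain ⟨δ, hδ, hmem⟩ := exists_ball_add_mem hΘ hv
  have hac : ∀ {P : E → Prop}, (∀ᵐ u ∂ν.restrict (Metric.ball 0 ε), P u) →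
      ∀ᵐ u ∂ballMeasure ν ε, P u := fun h => Measure.ae_smul_measure h _
  have hmb : ∀ᵐ u ∂ballMeasure ν ε, u ∈ Metric.ball (0 : E) ε :=
    hac (ae_restrict_mem measurableSet_ball)
  have hmeas : ∀ w ∈ Metric.ball v δ,
      AEStronglyMeasurable (fun u => ℓ (w + u)) (ballMeasure ν ε) := by
    intro w hw
    refine AEStronglyMeasurable.smul_measure ?_ _
    refine ContinuousOn.aestronglyMeasurable ?_ measurableSet_ball
    exact hℓ.continuousOn.comp (by fun_prop) fun u hu => hmem w hw u (Metric.ball_subset_closedBall hu)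
  have hvδ : v ∈ Metric.ball v δ := Metric.mem_ball_self hδ
  have hgm : Measurable fun u => gradientOn Θ ℓ (v + u) :=
    (measurable_gradientOn hΘ ℓ).comp (measurable_const_add v)
  have hgi : Integrable (fun u => gradientOn Θ ℓ (v + u)) (ballMeasure ν ε) :=
    Integrable.of_bound hgm.aestronglyMeasurable C
      (Filter.Eventually.of_forall fun u => norm_gradientOn_le hΘ hℓ _)
  have key := hasFDerivAt_integral_of_dominated_loc_of_lip (𝕜 := ℝ) (μ := ballMeasure ν ε)
    (F := fun w u => ℓ (w + u)) (F' := fun u => InnerProductSpace.toDual ℝ E (gradientOn Θ ℓ (v + u)))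
    (bound := fun _ => (C : ℝ)) (x₀ := v) (s := Metric.ball v δ) (Metric.ball_mem_nhds v hδ)
    (Filter.eventually_of_mem (Metric.ball_mem_nhds v hδ) hmeas) ?_ ?_ ?_ (integrable_const _) ?_
  · have hdual : InnerProductSpace.toDual ℝ E (∫ u, gradientOn Θ ℓ (v + u) ∂ballMeasure ν ε) =
        ∫ u, InnerProductSpace.toDual ℝ E (gradientOn Θ ℓ (v + u)) ∂ballMeasure ν ε := by
      ext y
      rw [InnerProductSpace.toDual_apply_apply, ContinuousLinearMap.integral_apply key.1,
        real_inner_comm, ← integral_inner hgi]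
      simp only [InnerProductSpace.toDual_apply_apply, real_inner_comm]
    rw [hasGradientAt_iff_hasFDerivAt, hdual]
    exact key.2
  · refine Integrable.of_bound (hmeas v hvδ) (|ℓ v| + C * ε) ?_
    filter_upwards [hmb] with u hu
    have h1 := hℓ.dist_le_mul (v + u) (hmem v hvδ u (Metric.ball_subset_closedBall hu)) v
      (hv (Metric.mem_closedBall_self hε.le))
    rw [dist_eq_norm, dist_eq_norm, add_sub_cancel_left] at h1
    have h2 : ‖u‖ ≤ ε := (mem_ball_zero_iff.1 hu).le
    have h3 := norm_add_le (ℓ (v + u) - ℓ v) (ℓ v)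
    rw [sub_add_cancel] at h3
    have h4 := mul_le_mul_of_nonneg_left h2 C.coe_nonneg
    simp only [Real.norm_eq_abs] at *
    linarith
  · exact ((InnerProductSpace.toDual ℝ E).continuous.measurable.comp hgm).aestronglyMeasurable
  · filter_upwards [hmb] with u hu
    rw [Real.nnabs_of_nonneg C.coe_nonneg, Real.toNNReal_coe]
    refine LipschitzOnWith.of_dist_le_mul fun x hx y hy => ?_
    simpa using hℓ.dist_le_mul (x + u) (hmem x hx u (Metric.ball_subset_closedBall hu)) (y + u)
      (hmem y hy u (Metric.ball_subset_closedBall hu))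
  · filter_upwards [hac (ae_ball_of_ae hf hΘ (Metric.ball_subset_closedBall.trans hv))] with u hu
    exact (hasFDerivAt_comp_add_right u).2 hu.hasFDerivAt

/-- The second ball contains the ball around `v` of radius `ε - dist v w`, and Bernoulli's
inequality bounds the volume of the remaining shell. The `+ 1` makes the estimate trivial for
distant centers, also in dimension zero. -/
theorem measureReal_ball_diff_le (hε : 0 < ε) (v w : E) :
    ν.real (Metric.ball v ε \ Metric.ball w ε) ≤
      (Module.finrank ℝ E + 1) / ε * dist v w * ν.real (Metric.ball 0 ε) := by
  have hfin : ∀ (x : E) (r : ℝ), ν (Metric.ball x r) ≠ ⊤ := fun x r => measure_ball_lt_top.ne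
  rcases lt_or_ge (dist v w) ε with h | h
  · have hr : 0 < ε - dist v w := sub_pos.2 h
    have h1 : Metric.ball v ε \ Metric.ball w ε ⊆
        Metric.ball v ε \ Metric.ball v (ε - dist v w) :=
      sdiff_subset_sdiff_right (Metric.ball_subset_ball' (by linarith))
    have hball : ∀ r > 0, ν.real (Metric.ball v r) =
        r ^ Module.finrank ℝ E * ν.real (Metric.ball 0 1) := fun r hr => by
      rw [Measure.real, Measure.addHaar_ball_of_pos ν v hr, ENNReal.toReal_mul,
        ENNReal.toReal_ofReal (by positivity), Measure.real]
    have h2 := measureReal_mono (μ := ν) h1 (measure_ne_top_of_subset sdiff_subset (hfin v ε))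
    rw [measureReal_sdiff (Metric.ball_subset_ball (by linarith [dist_nonneg (x := v) (y := w)]))
      measurableSet_ball (hfin v ε)] at h2
    refine h2.trans ?_
    rw [← Measure.addHaar_real_ball_center ν v, hball _ hr, hball _ hε]
    have hδ : dist v w / ε ≤ 1 := (div_le_one hε).2 h.le
    have h3 := one_add_mul_le_pow (a := -(dist v w / ε)) (by linarith) (Module.finrank ℝ E)
    have h4 : (ε - dist v w) ^ Module.finrank ℝ E =
        (1 + -(dist v w / ε)) ^ Module.finrank ℝ E * ε ^ Module.finrank ℝ E := by
      rw [← mul_pow]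
      congr 1
      field_simp
      ring
    set e := ε ^ Module.finrank ℝ E
    have he : 0 ≤ e := by positivity
    have hb : 0 ≤ ν.real (Metric.ball (0 : E) 1) := measureReal_nonneg
    rw [h4]
    have h5 : 1 - (1 + -(dist v w / ε)) ^ Module.finrank ℝ E ≤
        (Module.finrank ℝ E + 1) / ε * dist v w := by
      have h6 : 0 ≤ dist v w / ε := by positivity
      have h7 : ((Module.finrank ℝ E : ℝ) + 1) / ε * dist v w =
          Module.finrank ℝ E * (dist v w / ε) + dist v w / ε := by
        field_simp
      rw [h7]
      linarith
    have h8 := mul_le_mul_of_nonneg_right h5 (mul_nonneg he hb)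
    linarith
  · have h1 : ν.real (Metric.ball v ε \ Metric.ball w ε) ≤ ν.real (Metric.ball 0 ε) := by
      rw [← Measure.addHaar_real_ball_center ν v]
      exact measureReal_mono sdiff_subset (hfin v ε)
    refine h1.trans (le_mul_of_one_le_left measureReal_nonneg ?_)
    rw [div_mul_eq_mul_div, one_le_div hε]
    nlinarith [(Nat.cast_nonneg (Module.finrank ℝ E) : (0 : ℝ) ≤ Module.finrank ℝ E)]

/-- The average of a bounded function over a ball is a Lipschitz function of the center. -/
theorem norm_average_sub_le (hε : 0 < ε) {f : E → E} (hf : Measurable f) {C : ℝ}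
    (hC : ∀ x, ‖f x‖ ≤ C) (v w : E) :
    ‖(∫ u, f (v + u) ∂ballMeasure ν ε) - ∫ u, f (w + u) ∂ballMeasure ν ε‖ ≤
      2 * C * ((Module.finrank ℝ E + 1) / ε) * dist v w := by
  have hfin : ∀ (x : E), ν (Metric.ball x ε) < ⊤ := fun x => measure_ball_lt_top
  have hint : ∀ x, IntegrableOn f (Metric.ball x ε) ν := fun x =>
    Measure.integrableOn_of_bounded (hfin x).ne hf.aestronglyMeasurable
      (Filter.Eventually.of_forall hC)
  have hd : ∀ x y, ‖∫ u in Metric.ball x ε \ Metric.ball y ε, f u ∂ν‖ ≤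
      C * ((Module.finrank ℝ E + 1) / ε * dist x y * ν.real (Metric.ball 0 ε)) := fun x y =>
    (norm_setIntegral_le_of_norm_le_const_ae ((measure_mono sdiff_subset).trans_lt (hfin x))
      (Filter.Eventually.of_forall hC)).trans
      (mul_le_mul_of_nonneg_left (measureReal_ball_diff_le hε x y) ((norm_nonneg _).trans (hC 0)))
  -- The integrals over the intersection of the two balls cancel; the two set differences account
  -- for the factor 2.
  have h1 := integral_inter_add_sdiff (s := Metric.ball v ε) (t := Metric.ball w ε)
    measurableSet_ball (hint v)
  have h2 := integral_inter_add_sdiff (s := Metric.ball w ε) (t := Metric.ball v ε)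
    measurableSet_ball (hint w)
  have hpos : 0 < ν.real (Metric.ball (0 : E) ε) :=
    ENNReal.toReal_pos (Metric.measure_ball_pos ν 0 hε).ne' (hfin 0).ne
  rw [← setAverage_ball_eq, ← setAverage_ball_eq, setAverage_eq, setAverage_eq,
    Measure.addHaar_real_ball_center ν v, Measure.addHaar_real_ball_center ν w, ← smul_sub, ← h1,
    ← h2, inter_comm, add_sub_add_left_eq_sub, norm_smul, norm_inv, Real.norm_of_nonneg hpos.le,
    inv_mul_le_iff₀ hpos]
  refine (norm_sub_le _ _).trans ((add_le_add (hd v w) (hd w v)).trans_eq ?_)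
  rw [dist_comm w v]
  ring

/-- A potential of a continuous field is recovered by line integrals. -/
theorem integral_gradient_segment {W : Set E} (hW : Convex ℝ W) {h : E → ℝ} {g : E → E}
    (hg : ContinuousOn g W) (hh : ∀ v ∈ W, HasGradientAt h (g v) v) {x y : E} (hx : x ∈ W)
    (hy : y ∈ W) : ∫ s in (0 : ℝ)..1, inner ℝ (g (x + s • (y - x))) (y - x) = h y - h x := by
  have hmem : ∀ s ∈ uIcc (0 : ℝ) 1, x + s • (y - x) ∈ W := fun s hs =>
    hW.add_smul_sub_mem hx hy (by rwa [uIcc_of_le zero_le_one] at hs)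
  have hd : ∀ s ∈ uIcc (0 : ℝ) 1, HasDerivAt (fun s => h (x + s • (y - x)))
      (inner ℝ (g (x + s • (y - x))) (y - x)) s := by
    intro s hs
    have h1 : HasDerivAt (fun s : ℝ => x + s • (y - x)) (y - x) s := by
      simpa using ((hasDerivAt_id s).smul_const (y - x)).const_add x
    have h2 := (hh _ (hmem s hs)).hasFDerivAt.comp_hasDerivAt s h1
    rw [InnerProductSpace.toDual_apply_apply] at h2
    exact h2
  rw [intervalIntegral.integral_eq_sub_of_hasDerivAt hd]
  · simp
  · refine ContinuousOn.intervalIntegrable ?_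
    exact (hg.comp (by fun_prop) hmem).inner continuousOn_const

/-- First-order expansion of a function with Lipschitz gradient. -/
theorem abs_sub_sub_inner_le {W : Set E} (hW : Convex ℝ W) {h : E → ℝ} {g : E → E} {L : ℝ}
    (hg : ∀ v w, ‖g v - g w‖ ≤ L * dist v w) (hL : 0 ≤ L)
    (hh : ∀ v ∈ W, HasGradientAt h (g v) v) {x y : E} (hx : x ∈ W) (hy : y ∈ W) :
    |h y - h x - inner ℝ (g x) (y - x)| ≤ L * ‖y - x‖ ^ 2 := by
  have h1 := Convex.norm_image_sub_le_of_norm_hasFDerivWithin_le' (𝕜 := ℝ) (f := h)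
    (f' := fun z => InnerProductSpace.toDual ℝ E (g z)) (φ := InnerProductSpace.toDual ℝ E (g x))
    (C := L * ‖y - x‖) (s := segment ℝ x y)
    (fun z hz => (hh z (hW.segment_subset hx hy hz)).hasFDerivAt.hasFDerivWithinAt) (fun z hz => ?_)
    (convex_segment x y) (left_mem_segment ℝ x y) (right_mem_segment ℝ x y)
  · rw [InnerProductSpace.toDual_apply_apply, Real.norm_eq_abs] at h1
    exact h1.trans_eq (by ring)
  · rw [← map_sub, LinearIsometryEquiv.norm_map]
    refine (hg z x).trans (mul_le_mul_of_nonneg_left ?_ hL)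
    rw [dist_eq_norm]
    exact norm_sub_le_of_mem_segment hz

end Average

end InverseGame

namespace InverseGame

/-! ### Stochastic gradient steps with sampled gradients -/

/-- The increments of `a ^ 2` are at most `(2 * a t + M * η t) * (M * η t)`, which is summable, so
`a` converges. A positive limit would bound `η t` eventually by a multiple of `η t * a t` and make
`η` summable. -/
theorem tendsto_zero_of_summable_mul {a η : ℕ → ℝ} (ha : ∀ t, 0 ≤ a t) (hη : ∀ t, 0 < η t)
    (hη_sum : ¬ Summable η) (hη_sq : Summable fun t => η t ^ 2)
    (hsum : Summable fun t => η t * a t) {M : ℝ} (hM : ∀ t, |a (t + 1) - a t| ≤ M * η t) :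
    Filter.Tendsto a Filter.atTop (nhds 0) := by
  have hM0 : 0 ≤ M := nonneg_of_mul_nonneg_left ((abs_nonneg _).trans (hM 0)) (hη 0)
  have hcauchy : CauchySeq fun t => a t ^ 2 := by
    refine cauchySeq_of_dist_le_of_summable
      (fun t => 2 * M * (η t * a t) + M ^ 2 * η t ^ 2) (fun t => ?_)
      ((hsum.mul_left _).add (hη_sq.mul_left _))
    have h1 := abs_le.1 (hM t)
    have h2 : 0 ≤ a t + a (t + 1) := add_nonneg (ha t) (ha (t + 1))
    rw [dist_comm, Real.dist_eq, sq_sub_sq, abs_mul, abs_of_nonneg (by linarith)]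
    calc (a (t + 1) + a t) * |a (t + 1) - a t| ≤ (2 * a t + M * η t) * (M * η t) :=
          mul_le_mul (by linarith) (hM t) (abs_nonneg _) (by linarith)
      _ = _ := by ring
  obtain ⟨α, hα⟩ := cauchySeq_tendsto_of_complete hcauchy
  have hα0 : 0 ≤ α := ge_of_tendsto' hα fun t => sq_nonneg _
  have hsqrt : Filter.Tendsto a Filter.atTop (nhds (Real.sqrt α)) :=
    ((Real.continuous_sqrt.tendsto α).comp hα).congr fun t => Real.sqrt_sq (ha t)
  rcases hα0.eq_or_lt with h | h
  · rwa [← h, Real.sqrt_zero] at hsqrt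
  · refine absurd ?_ hη_sum
    have hβ : 0 < Real.sqrt α := Real.sqrt_pos.2 h
    refine Summable.of_norm_bounded_eventually_nat (hsum.mul_left (2 / Real.sqrt α)) ?_
    filter_upwards [hsqrt.eventually (lt_mem_nhds (half_lt_self hβ))] with t ht
    rw [Real.norm_of_nonneg (hη t).le, div_mul_eq_mul_div, le_div_iff₀ hβ]
    nlinarith [hη t]

section Sampling

set_option linter.unusedSectionVars false

variable {E : Type*} [NormedAddCommGroup E] [InnerProductSpace ℝ E] [FiniteDimensional ℝ E]
  [CompleteSpace E] [MeasurableSpace E] [BorelSpace E] {ν : Measure E} [ν.IsAddHaarMeasure]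
  {ε : ℝ} {K : ℕ} {Ω : Type*} [MeasurableSpace Ω] {P : Measure Ω}

variable (ν ε) in
/-- The average of the fields `F k` over `k` and over the ball of radius `ε` around `v`. -/
noncomputable def meanField (F : Fin K → E → E) (v : E) : E :=
  (1 / (K : ℝ)) • ∑ k, ∫ u, F k (v + u) ∂ballMeasure ν ε

/-- The iterates of the sampled gradient steps with the fields `F k`. -/
noncomputable def sampledIterate (F : Fin K → E → E) (η : ℕ → ℝ) (θ₀ : E) (κ : ℕ → Ω → Fin K)
    (U : ℕ → Ω → E) : ℕ → Ω → E
  | 0, _ => θ₀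
  | t + 1, ω => sampledIterate F η θ₀ κ U t ω -
      η t • F (κ t ω) (sampledIterate F η θ₀ κ U t ω + U t ω)

/-- Independent draws `κ t`, uniform on `Fin K`, and `U t`, uniform on the ball of radius `ε`. -/
structure IsSampling (ν : Measure E) (ε : ℝ) (P : Measure Ω) (κ : ℕ → Ω → Fin K)
    (U : ℕ → Ω → E) : Prop where
  measurable_index : ∀ t, Measurable (κ t)
  measurable_shift : ∀ t, Measurable (U t)
  map_index : ∀ t, P.map (κ t) = ProbabilityTheory.cond Measure.count univ
  map_shift : ∀ t, P.map (U t) = ballMeasure ν ε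
  indep_step : ∀ t, ProbabilityTheory.IndepFun (κ t) (U t) P
  indep_steps : ProbabilityTheory.iIndepFun (fun t ω => (κ t ω, U t ω)) P

variable {κ : ℕ → Ω → Fin K} {U : ℕ → Ω → E} {F : Fin K → E → E} {η : ℕ → ℝ} {θ₀ : E} {C : ℝ}

theorem measurable_field (hF : ∀ k, Measurable (F k)) :
    Measurable fun x : E × Fin K × E => F x.2.1 (x.1 + x.2.2) := by
  have h : Measurable fun y : Fin K × E => F y.1 y.2 := measurable_from_prod_countable_right hF
  have h2 : Measurable fun x : E × Fin K × E => (x.2.1, x.1 + x.2.2) := by fun_prop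
  exact h.comp h2

/-- The sigma-algebra is arbitrary so that the lemma serves both for the ambient one and for the one
generated by the draws before `t`. -/
theorem measurable_sampledIterate_of_le (hF : ∀ k, Measurable (F k)) {m : MeasurableSpace Ω}
    (t : ℕ) (h : ∀ s < t, Measurable[m] fun ω => (κ s ω, U s ω)) :
    Measurable[m] (sampledIterate F η θ₀ κ U t) := by
  induction t with
  | zero => exact measurable_const
  | succ t ih =>
    have h1 := ih fun s hs => h s (hs.trans (Nat.lt_succ_self t))
    have h2 : Measurable[m] fun ω => (sampledIterate F η θ₀ κ U t ω, (κ t ω, U t ω)) :=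
      h1.prodMk (h t (Nat.lt_succ_self t))
    exact h1.sub (((measurable_field hF).comp h2).const_smul (η t))

theorem IsSampling.measurable_draw (h : IsSampling ν ε P κ U) (t : ℕ) :
    Measurable fun ω => (κ t ω, U t ω) :=
  (h.measurable_index t).prodMk (h.measurable_shift t)

theorem IsSampling.measurable_sampledIterate (h : IsSampling ν ε P κ U)
    (hF : ∀ k, Measurable (F k)) (t : ℕ) : Measurable (sampledIterate F η θ₀ κ U t) :=
  measurable_sampledIterate_of_le hF t fun s _ => h.measurable_draw s

/-- The iterate at time `t` is a function of the draws before `t`, which are jointly independent of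
draw `t`. -/
theorem IsSampling.indepFun_sampledIterate (h : IsSampling ν ε P κ U)
    (hF : ∀ k, Measurable (F k)) (t : ℕ) :
    ProbabilityTheory.IndepFun (sampledIterate F η θ₀ κ U t) (fun ω => (κ t ω, U t ω)) P := by
  have h1 := ProbabilityTheory.indep_iSup_of_disjoint
    (m := fun i => MeasurableSpace.comap (fun ω => (κ i ω, U i ω)) inferInstance)
    (fun i => (h.measurable_draw i).comap_le) h.indep_steps (S := Iio t) (T := {t}) (by simp)
  rw [ProbabilityTheory.IndepFun_iff_Indep]
  refine ProbabilityTheory.indep_of_indep_of_le_left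
    (ProbabilityTheory.indep_of_indep_of_le_right h1 ?_) ?_
  · simp
  · refine Measurable.comap_le (measurable_sampledIterate_of_le hF t fun s hs => ?_)
    exact Measurable.mono (comap_measurable _) (le_iSup₂_of_le s hs le_rfl) le_rfl

theorem IsSampling.map_prod [IsProbabilityMeasure P] (h : IsSampling ν ε P κ U)
    (hF : ∀ k, Measurable (F k)) (t : ℕ) :
    P.map (fun ω => (sampledIterate F η θ₀ κ U t ω, (κ t ω, U t ω))) =
      (P.map (sampledIterate F η θ₀ κ U t)).prod
        ((ProbabilityTheory.cond Measure.count univ).prod (ballMeasure ν ε)) := by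
  rw [(ProbabilityTheory.indepFun_iff_map_prod_eq_prod_map_map
    (h.measurable_sampledIterate hF t).aemeasurable (h.measurable_draw t).aemeasurable).1
      (h.indepFun_sampledIterate hF t),
    (ProbabilityTheory.indepFun_iff_map_prod_eq_prod_map_map
      (h.measurable_index t).aemeasurable (h.measurable_shift t).aemeasurable).1 (h.indep_step t),
    h.map_index, h.map_shift]

/-- The sampling points avoid null sets. -/
theorem IsSampling.ae_sampledIterate_add [IsProbabilityMeasure P] (h : IsSampling ν ε P κ U)
    (hε : 0 < ε) (hF : ∀ k, Measurable (F k)) (t : ℕ) {Q : E → Prop} (hQ : ∀ᵐ x ∂ν, Q x) :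
    ∀ᵐ ω ∂P, Q (sampledIterate F η θ₀ κ U t ω + U t ω) := by
  have := isProbabilityMeasure_ballMeasure (ν := ν) hε
  have hi : ProbabilityTheory.IndepFun (sampledIterate F η θ₀ κ U t) (U t) P :=
    (h.indepFun_sampledIterate hF t).comp measurable_id measurable_snd
  have hX := h.measurable_sampledIterate (η := η) (θ₀ := θ₀) hF t
  have hmap := (ProbabilityTheory.indepFun_iff_map_prod_eq_prod_map_map hX.aemeasurable
    (h.measurable_shift t).aemeasurable).1 hi
  rw [h.map_shift] at hmap
  have hpm : Measurable fun ω => (sampledIterate F η θ₀ κ U t ω, U t ω) :=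
    hX.prodMk (h.measurable_shift t)
  -- `Q` need not be measurable, so its exceptional set is enlarged to a measurable null set. For
  -- each frozen iterate the bad shifts form a translate of a null set, and Fubini concludes.
  set N := toMeasurable ν {x | ¬ Q x}
  have hN : ν N = 0 := (measure_toMeasurable _).trans hQ
  have hNm : MeasurableSet N := measurableSet_toMeasurable _ _
  have hS : MeasurableSet {y : E × E | y.1 + y.2 ∈ N} :=
    (measurable_fst.add measurable_snd) hNm
  have h0 : P ((fun ω => (sampledIterate F η θ₀ κ U t ω, U t ω)) ⁻¹' {y : E × E | y.1 + y.2 ∈ N})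
      = 0 := by
    rw [← Measure.map_apply hpm hS, hmap, Measure.measure_prod_null hS]
    refine Filter.Eventually.of_forall fun v => ?_
    refine ProbabilityTheory.cond_absolutelyContinuous ?_
    exact (measurePreserving_add_left ν v).quasiMeasurePreserving.preimage_null hN
  refine measure_mono_null (fun ω hω => ?_) h0
  exact subset_toMeasurable ν _ hω

/-- Iterates computed with almost everywhere equal fields agree almost surely. -/
theorem IsSampling.ae_eq_sampledIterate [IsProbabilityMeasure P] (h : IsSampling ν ε P κ U)
    (hε : 0 < ε) (hF : ∀ k, Measurable (F k)) {Θ : Set E} (hΘ : IsOpen Θ) {f : Fin K → E → E}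
    (hf : ∀ k, f k =ᵐ[ν.restrict Θ] F k) {θ : ℕ → Ω → E} (h0 : ∀ ω, θ 0 ω = θ₀)
    (hstep : ∀ t ω, θ (t + 1) ω = θ t ω - η t • f (κ t ω) (θ t ω + U t ω))
    (hstay : ∀ᵐ ω ∂P, ∀ t, Metric.closedBall (θ t ω) ε ⊆ Θ) (t : ℕ) :
    θ t =ᵐ[P] sampledIterate F η θ₀ κ U t := by
  induction t with
  | zero => exact Filter.Eventually.of_forall h0
  | succ t ih =>
    have h1 : ∀ᵐ x ∂ν, ∀ k, x ∈ Θ → f k x = F k x :=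
      ae_all_iff.2 fun k => (ae_restrict_iff' hΘ.measurableSet).1 (hf k)
    have h2 : ∀ᵐ ω ∂P, U t ω ∈ Metric.ball (0 : E) ε := by
      refine ae_of_ae_map (h.measurable_shift t).aemeasurable ?_
      rw [h.map_shift]
      exact Measure.ae_smul_measure (ae_restrict_mem measurableSet_ball) _
    -- The sampling point lies in `Θ` because the closed ball does, and almost surely outside the
    -- null set where `f` and `F` differ.
    filter_upwards [ih, hstay, h2, h.ae_sampledIterate_add (η := η) (θ₀ := θ₀) hε hF t h1]
      with ω hω hs hu hQ
    rw [hstep, hω, sampledIterate, hQ]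
    have := hs t
    rw [hω] at this
    exact this (by simpa [dist_eq_norm] using (mem_ball_zero_iff.1 hu).le)

theorem integral_cond_count (φ : Fin K → ℝ) :
    ∫ k, φ k ∂(ProbabilityTheory.cond Measure.count univ) = (1 / (K : ℝ)) * ∑ k, φ k := by
  rw [ProbabilityTheory.cond, Measure.restrict_univ, integral_smul_measure, integral_count,
    Measure.count_univ]
  simp

theorem norm_meanField_le (hε : 0 < ε) (hC0 : 0 ≤ C) (hC : ∀ k x, ‖F k x‖ ≤ C) (v : E) :
    ‖meanField ν ε F v‖ ≤ C := by
  have := isProbabilityMeasure_ballMeasure (ν := ν) hε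
  rw [meanField, norm_smul, Real.norm_of_nonneg (by positivity), one_div]
  refine inv_mul_le_of_le_mul₀ (by positivity) hC0 ?_
  refine (norm_sum_le_of_le (f := fun k => ∫ u, F k (v + u) ∂ballMeasure ν ε) Finset.univ
    (n := fun _ => C) fun k _ => ?_).trans (by simp)
  simpa using norm_integral_le_of_norm_le_const (μ := ballMeasure ν ε) (C := C)
    (Filter.Eventually.of_forall fun u => hC k (v + u))

theorem norm_meanField_sub_le (hε : 0 < ε) (hC0 : 0 ≤ C) (hF : ∀ k, Measurable (F k))
    (hC : ∀ k x, ‖F k x‖ ≤ C) (v w : E) :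
    ‖meanField ν ε F v - meanField ν ε F w‖ ≤
      2 * C * ((Module.finrank ℝ E + 1) / ε) * dist v w := by
  rw [meanField, meanField, ← smul_sub, ← Finset.sum_sub_distrib, norm_smul,
    Real.norm_of_nonneg (by positivity), one_div]
  refine inv_mul_le_of_le_mul₀ (by positivity) (by positivity) ?_
  refine (norm_sum_le_of_le Finset.univ
    (n := fun _ => 2 * C * ((Module.finrank ℝ E + 1) / ε) * dist v w) fun k _ => ?_).trans (by simp)
  exact norm_average_sub_le hε (hF k) (hC k) v w

theorem continuous_meanField (hε : 0 < ε) (hC0 : 0 ≤ C) (hF : ∀ k, Measurable (F k))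
    (hC : ∀ k x, ‖F k x‖ ≤ C) : Continuous (meanField ν ε F) := by
  refine (LipschitzWith.of_dist_le_mul (K := (2 * C * ((Module.finrank ℝ E + 1) / ε)).toNNReal)
    fun v w => ?_).continuous
  rw [dist_eq_norm, Real.coe_toNNReal _ (by positivity)]
  exact norm_meanField_sub_le hε hC0 hF hC v w

/-- The conditional mean of a sampled gradient is the mean field. -/
theorem IsSampling.integral_inner [IsProbabilityMeasure P] (h : IsSampling ν ε P κ U)
    (hε : 0 < ε) (hC0 : 0 ≤ C) (hF : ∀ k, Measurable (F k)) (hC : ∀ k x, ‖F k x‖ ≤ C) (t : ℕ) :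
    ∫ ω, inner ℝ (meanField ν ε F (sampledIterate F η θ₀ κ U t ω))
        (F (κ t ω) (sampledIterate F η θ₀ κ U t ω + U t ω)) ∂P =
      ∫ ω, ‖meanField ν ε F (sampledIterate F η θ₀ κ U t ω)‖ ^ 2 ∂P := by
  have := isProbabilityMeasure_ballMeasure (ν := ν) hε
  have hX := h.measurable_sampledIterate (η := η) (θ₀ := θ₀) hF t
  have hg := (continuous_meanField (ν := ν) hε hC0 hF hC).measurable
  have : IsProbabilityMeasure (P.map (sampledIterate F η θ₀ κ U t)) :=
    Measure.isProbabilityMeasure_map hX.aemeasurable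
  have : IsProbabilityMeasure (ProbabilityTheory.cond (Measure.count : Measure (Fin K)) univ) := by
    rw [← h.map_index t]
    exact Measure.isProbabilityMeasure_map (h.measurable_index t).aemeasurable
  have hm : Measurable fun x : E × Fin K × E =>
      (inner ℝ (meanField ν ε F x.1) (F x.2.1 (x.1 + x.2.2)) : ℝ) :=
    (hg.comp measurable_fst).inner (measurable_field hF)
  have hbound : ∀ x : E × Fin K × E,
      ‖(inner ℝ (meanField ν ε F x.1) (F x.2.1 (x.1 + x.2.2)) : ℝ)‖ ≤ C * C := fun x =>
    (norm_inner_le_norm _ _).trans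
      (mul_le_mul (norm_meanField_le hε hC0 hC _) (hC _ _) (norm_nonneg _) hC0)
  have h1 := integral_map (μ := P)
    (φ := fun ω => (sampledIterate F η θ₀ κ U t ω, (κ t ω, U t ω)))
    (hX.prodMk (h.measurable_draw t)).aemeasurable hm.aestronglyMeasurable
  rw [h.map_prod hF, integral_prod _ (Integrable.of_bound hm.aestronglyMeasurable (C * C)
    (Filter.Eventually.of_forall hbound))] at h1
  rw [← h1]
  -- With the iterate frozen at `v`, integrating over index and shift turns the sampled field into
  -- the mean field at `v`.
  have h2 : ∀ v : E, ∫ y : Fin K × E, inner ℝ (meanField ν ε F v) (F y.1 (v + y.2))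
      ∂((ProbabilityTheory.cond Measure.count univ).prod (ballMeasure ν ε)) =
      ‖meanField ν ε F v‖ ^ 2 := by
    intro v
    have hv : Measurable fun y : Fin K × E =>
        (inner ℝ (meanField ν ε F v) (F y.1 (v + y.2)) : ℝ) := hm.comp measurable_prodMk_left
    rw [integral_prod _ (Integrable.of_bound hv.aestronglyMeasurable (C * C)
      (Filter.Eventually.of_forall fun y => hbound (v, y))), integral_cond_count]
    have h3 : ∀ k, ∫ u, inner ℝ (meanField ν ε F v) (F k (v + u)) ∂ballMeasure ν ε =
        inner ℝ (meanField ν ε F v) (∫ u, F k (v + u) ∂ballMeasure ν ε) := fun k =>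
      _root_.integral_inner (Integrable.of_bound
        ((hF k).comp (measurable_const_add v)).aestronglyMeasurable C
        (Filter.Eventually.of_forall fun u => hC k _)) _
    simp only [h3]
    rw [← inner_sum, ← real_inner_smul_right, ← meanField, real_inner_self_eq_norm_sq]
  simp only [h2]
  exact integral_map hX.aemeasurable (hg.norm.pow_const 2).aestronglyMeasurable

theorem norm_sampledIterate_succ_sub_le (hη : ∀ t, 0 < η t) (hC : ∀ k x, ‖F k x‖ ≤ C) (t : ℕ)
    (ω : Ω) : dist (sampledIterate F η θ₀ κ U (t + 1) ω) (sampledIterate F η θ₀ κ U t ω) ≤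
      C * η t := by
  rw [dist_eq_norm, sampledIterate, sub_sub_cancel_left, norm_neg, norm_smul,
    Real.norm_of_nonneg (hη t).le, mul_comm]
  exact mul_le_mul_of_nonneg_right (hC _ _) (hη t).le

/-- Exponent 2 serves the descent argument, exponent 1 the integrability claim of the main theorem.
-/
theorem IsSampling.integrable_meanField [IsProbabilityMeasure P] (h : IsSampling ν ε P κ U)
    (hε : 0 < ε) (hC0 : 0 ≤ C) (hF : ∀ k, Measurable (F k)) (hC : ∀ k x, ‖F k x‖ ≤ C) (t : ℕ)
    (q : ℕ) :
    Integrable (fun ω => ‖meanField ν ε F (sampledIterate F η θ₀ κ U t ω)‖ ^ q) P := by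
  have hg := (continuous_meanField (ν := ν) hε hC0 hF hC).measurable
  refine Integrable.of_bound ((hg.comp (h.measurable_sampledIterate hF t)).norm.pow_const
    q).aestronglyMeasurable (C ^ q) (Filter.Eventually.of_forall fun ω => ?_)
  rw [norm_pow, norm_norm]
  exact pow_le_pow_left₀ (norm_nonneg _) (norm_meanField_le hε hC0 hC _) q

/-- Convergence of sampled gradient steps: if the mean field is the gradient of a nonnegative
function on a convex set that contains all iterates, then its expected norm along the iterates
tends to zero. -/
theorem IsSampling.tendsto_integral_norm_meanField [IsProbabilityMeasure P]
    (h : IsSampling ν ε P κ U) (hε : 0 < ε) (hC0 : 0 ≤ C) (hF : ∀ k, Measurable (F k))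
    (hC : ∀ k x, ‖F k x‖ ≤ C) (hη : ∀ t, 0 < η t) (hη_sum : ¬ Summable η)
    (hη_sq : Summable fun t => η t ^ 2) {W : Set E} (hW : Convex ℝ W) {φ : E → ℝ}
    (hφ : ∀ v ∈ W, HasGradientAt φ (meanField ν ε F v) v) (hφ0 : ∀ v ∈ W, 0 ≤ φ v)
    (hmem : ∀ᵐ ω ∂P, ∀ t, sampledIterate F η θ₀ κ U t ω ∈ W) :
    Filter.Tendsto (fun t => ∫ ω, ‖meanField ν ε F (sampledIterate F η θ₀ κ U t ω)‖ ∂P)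
      Filter.atTop (nhds 0) := by
  set X := sampledIterate F η θ₀ κ U with hX
  set g := meanField ν ε F with hg
  set L := 2 * C * ((Module.finrank ℝ E + 1) / ε) with hL
  have hL0 : 0 ≤ L := by positivity
  have hlip : ∀ v w, ‖g v - g w‖ ≤ L * dist v w := norm_meanField_sub_le hε hC0 hF hC
  have hgC : ∀ v, ‖g v‖ ≤ C := norm_meanField_le hε hC0 hC
  have hgm : Measurable g := (continuous_meanField hε hC0 hF hC).measurable
  have hXm : ∀ t, Measurable (X t) := fun t => h.measurable_sampledIterate hF t
  have hint : ∀ t q, Integrable (fun ω => ‖g (X t ω)‖ ^ q) P :=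
    fun t q => h.integrable_meanField hε hC0 hF hC t q
  set D : ℕ → Ω → ℝ := fun t ω => inner ℝ (g (X t ω)) (F (κ t ω) (X t ω + U t ω)) with hD
  have hDint : ∀ t, Integrable (D t) P := fun t => by
    refine Integrable.of_bound ((hgm.comp (hXm t)).inner ((measurable_field hF).comp
      ((hXm t).prodMk (h.measurable_draw t)))).aestronglyMeasurable (C * C)
      (Filter.Eventually.of_forall fun ω => ?_)
    exact (norm_inner_le_norm _ _).trans (mul_le_mul (hgC _) (hC _ _) (norm_nonneg _) hC0)
  set a : ℕ → ℝ := fun t => ∫ ω, ‖g (X t ω)‖ ^ 2 ∂P with ha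
  have ha0 : ∀ t, 0 ≤ a t := fun t => integral_nonneg fun ω => sq_nonneg _
  have hDa : ∀ t, ∫ ω, D t ω ∂P = a t := fun t => h.integral_inner hε hC0 hF hC t
  have hdescent : ∀ᵐ ω ∂P, ∀ T, ∑ t ∈ Finset.range T, η t * D t ω ≤
      φ θ₀ + L * C ^ 2 * ∑' t, η t ^ 2 := by
    filter_upwards [hmem] with ω hω T
    -- The descent inequality: first-order expansion of `φ` along a step of length at most `C * η
    -- t`. Summation telescopes, and the final value of `φ` is dropped since it is nonnegative.
    have hstep : ∀ t, η t * D t ω ≤ φ (X t ω) - φ (X (t + 1) ω) + L * C ^ 2 * η t ^ 2 := by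
      intro t
      have h1 := abs_le.1 (abs_sub_sub_inner_le hW hlip hL0 hφ (hω t) (hω (t + 1)))
      have h2 : X (t + 1) ω - X t ω = -(η t • F (κ t ω) (X t ω + U t ω)) := by
        rw [hX, sampledIterate, sub_sub_cancel_left]
      have h3 : inner ℝ (g (X t ω)) (X (t + 1) ω - X t ω) = -(η t * D t ω) := by
        rw [h2, inner_neg_right, real_inner_smul_right]
      have h4 : ‖X (t + 1) ω - X t ω‖ ^ 2 ≤ (C * η t) ^ 2 := by
        rw [← dist_eq_norm]
        exact pow_le_pow_left₀ dist_nonneg (norm_sampledIterate_succ_sub_le hη hC t ω) 2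
      have h5 := mul_le_mul_of_nonneg_left h4 hL0
      rw [mul_pow] at h5
      rw [h3] at h1
      linarith [h1.2]
    have h1 := Finset.sum_le_sum fun t (_ : t ∈ Finset.range T) => hstep t
    rw [Finset.sum_add_distrib, Finset.sum_range_sub' (fun t => φ (X t ω)), ← Finset.mul_sum] at h1
    have h2 : ∑ t ∈ Finset.range T, η t ^ 2 ≤ ∑' t, η t ^ 2 :=
      hη_sq.sum_le_tsum _ fun t _ => sq_nonneg _
    have h3 := mul_le_mul_of_nonneg_left h2 (mul_nonneg hL0 (sq_nonneg C))
    have h4 := hφ0 _ (hω T)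
    have h5 : X 0 ω = θ₀ := rfl
    rw [h5] at h1
    linarith
  have hsum : Summable fun t => η t * a t := by
    refine summable_of_sum_range_le (c := φ θ₀ + L * C ^ 2 * ∑' t, η t ^ 2)
      (fun t => mul_nonneg (hη t).le (ha0 t)) fun T => ?_
    have h1 : ∑ t ∈ Finset.range T, η t * a t =
        ∫ ω, ∑ t ∈ Finset.range T, η t * D t ω ∂P := by
      rw [integral_finsetSum _ fun t _ => (hDint t).const_mul _]
      exact Finset.sum_congr rfl fun t _ => by rw [integral_const_mul, hDa]
    rw [h1]
    refine (integral_mono_ae (integrable_finsetSum _ fun t _ => (hDint t).const_mul _)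
      (integrable_const _) (hdescent.mono fun ω hω => hω T)).trans_eq ?_
    simp
  -- The squared norm is a difference of squares: the sum of the norms is at most `2 * C`, their
  -- difference at most `L` times the step length.
  have hdiff : ∀ t, |a (t + 1) - a t| ≤ 2 * C * (L * C) * η t := by
    intro t
    rw [ha, ← integral_sub (hint _ 2) (hint _ 2), ← Real.norm_eq_abs]
    refine (norm_integral_le_of_norm_le_const (C := 2 * C * (L * C) * η t)
      (Filter.Eventually.of_forall fun ω => ?_)).trans_eq (by simp)
    have h1 : |‖g (X (t + 1) ω)‖ - ‖g (X t ω)‖| ≤ L * (C * η t) :=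
      (abs_norm_sub_norm_le _ _).trans ((hlip _ _).trans
        (mul_le_mul_of_nonneg_left (norm_sampledIterate_succ_sub_le hη hC t ω) hL0))
    rw [Real.norm_eq_abs, sq_sub_sq, abs_mul, abs_of_nonneg (by positivity)]
    calc (‖g (X (t + 1) ω)‖ + ‖g (X t ω)‖) * |‖g (X (t + 1) ω)‖ - ‖g (X t ω)‖|
        ≤ (2 * C) * (L * (C * η t)) :=
          mul_le_mul (by linarith [hgC (X (t + 1) ω), hgC (X t ω)]) h1 (abs_nonneg _)
            (by positivity)
      _ = _ := by ring
  have hlim := tendsto_zero_of_summable_mul ha0 hη hη_sum hη_sq hsum hdiff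
  have hsqrt : Filter.Tendsto (fun t => Real.sqrt (a t)) Filter.atTop (nhds 0) := by
    have h1 := (Real.continuous_sqrt.tendsto 0).comp hlim
    rwa [Real.sqrt_zero] at h1
  refine squeeze_zero (fun t => integral_nonneg fun ω => norm_nonneg _) (fun t => ?_) hsqrt
  refine Real.le_sqrt_of_sq_le ?_
  have hmemLp : MemLp (fun ω => ‖g (X t ω)‖) 2 P :=
    MemLp.of_bound (hgm.comp (hXm t)).norm.aestronglyMeasurable C
      (Filter.Eventually.of_forall fun ω => by rw [norm_norm]; exact hgC _)
  -- Nonnegative variance gives the Jensen bound of the squared mean by the mean square.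
  have hvar := ProbabilityTheory.variance_nonneg (fun ω => ‖g (X t ω)‖) P
  rw [ProbabilityTheory.variance_eq_sub hmemLp] at hvar
  exact sub_nonneg.1 hvar

end Sampling

end InverseGame

namespace InverseGame

/-! ### The averaged loss as a potential of the mean field -/

section PotentialOfMeanField

variable {E : Type*} [NormedAddCommGroup E] [InnerProductSpace ℝ E] [FiniteDimensional ℝ E]
  [CompleteSpace E] [MeasurableSpace E] [BorelSpace E] {ν : Measure E} [ν.IsAddHaarMeasure]
  {Θ : Set E} {ε : ℝ} {K : ℕ}

variable (ν ε) in
/-- The average of the functions `ℓ k` over `k` and over the ball of radius `ε` around `v`. -/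
noncomputable def meanLoss (ℓ : Fin K → E → ℝ) (v : E) : ℝ :=
  (1 / (K : ℝ)) * ∑ k, ∫ u, ℓ k (v + u) ∂ballMeasure ν ε

theorem hasGradientAt_meanLoss (hΘ : IsOpen Θ) (hε : 0 < ε) {ℓ : Fin K → E → ℝ} {C : NNReal}
    (hℓ : ∀ k, LipschitzOnWith C (ℓ k) Θ)
    (hf : ∀ k, ∀ᵐ x ∂ν.restrict Θ, HasGradientAt (ℓ k) (gradientOn Θ (ℓ k) x) x)
    {v : E} (hv : Metric.closedBall v ε ⊆ Θ) :
    HasGradientAt (meanLoss ν ε ℓ) (meanField ν ε (fun k => gradientOn Θ (ℓ k)) v) v := by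
  rw [hasGradientAt_iff_hasFDerivAt, meanField, map_smulₛₗ, map_sum]
  exact (HasFDerivAt.fun_sum fun k _ =>
    (hasGradientAt_average hΘ hε (hℓ k) (hf k) hv).hasFDerivAt).const_mul _

end PotentialOfMeanField

namespace Game

variable {n m l p q K : ℕ} {G : InverseGame.Game n m l p q} {xbar : Fin K → Profile n m}
  {μ : Fin K → Fin q → ℝ} {Θ : Set (Param p)} {ε : ℝ}

theorem smoothedGrad_eq_meanField (hΘ : IsOpen Θ)
    (hgrad : ∀ k, G.lossGrad (xbar k) (μ k) =ᵐ[volume.restrict Θ]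
      gradientOn Θ (G.loss (xbar k) (μ k))) {v : Param p} (hv : Metric.closedBall v ε ⊆ Θ) :
    G.smoothedGrad xbar μ ε v =
      meanField volume ε (fun k => gradientOn Θ (G.loss (xbar k) (μ k))) v := by
  rw [smoothedGrad, meanField]
  congr 1
  refine Finset.sum_congr rfl fun k _ => ?_
  rw [setAverage_ball_eq]
  exact integral_congr_ae (Measure.ae_smul_measure
    (ae_ball_of_ae (hgrad k) hΘ (Metric.ball_subset_closedBall.trans hv)) _)

/-- A uniform law is by definition the conditioned reference measure, so the fields match without
further argument. -/
theorem IsRun.isSampling {η : ℕ → ℝ} {θ₀ : Param p} {Ω : Type*} [MeasurableSpace Ω]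
    {P : Measure Ω} {κ : ℕ → Ω → Fin K} {U : ℕ → Ω → Param p} {θ : ℕ → Ω → Param p}
    (h : G.IsRun xbar μ Θ ε η θ₀ P κ U θ) : IsSampling volume ε P κ U :=
  ⟨h.measurable_index, h.measurable_shift, h.uniform_index, h.uniform_shift, h.indep_step,
    h.indep_steps⟩

end Game

end InverseGame

/-! ### Convergence of the active-set algorithm -/

theorem mainTheorem1 {n m l p q K : ℕ} (G : InverseGame.Game n m l p q)
    (xbar : Fin K → InverseGame.Profile n m) (μ : Fin K → Fin q → ℝ)
    (Θ : Set (InverseGame.Param p)) (hΘ_open : IsOpen Θ) (hΘ_convex : Convex ℝ Θ)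
    (hG : G.Regular Θ μ) (hCQ : G.ConstraintQualifications Θ μ)
    (hWD : G.WellBehavedDerivatives Θ μ)
    (ε : ℝ) (hε : 0 < ε)
    (η : ℕ → ℝ) (hη_pos : ∀ t, 0 < η t) (hη_sum : ¬ Summable η)
    (hη_sq : Summable fun t => η t ^ 2)
    (θ₀ : InverseGame.Param p)
    {Ω : Type*} [MeasurableSpace Ω] (P : MeasureTheory.Measure Ω)
    [MeasureTheory.IsProbabilityMeasure P]
    (κ : ℕ → Ω → Fin K) (U : ℕ → Ω → InverseGame.Param p) (θ : ℕ → Ω → InverseGame.Param p)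
    (hrun : G.IsRun xbar μ Θ ε η θ₀ P κ U θ) :
    -- the Nash equilibrium induced by the parameters is unique
    (∀ ϑ ∈ Θ, ∀ k, ∃! x, G.IsNash ϑ (μ k) x) ∧
    -- the gradients used by the algorithm are, almost everywhere, gradients of the loss
    (∀ᵐ ϑ ∂(MeasureTheory.volume.restrict Θ), ∀ k,
      HasGradientAt (G.loss (xbar k) (μ k)) (G.lossGrad (xbar k) (μ k) ϑ) ϑ) ∧
    -- the smoothed loss is well defined and differentiable, with the averaged gradient
    (∀ ϑ, Metric.closedBall ϑ ε ⊆ Θ →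
      (∀ k, MeasureTheory.IntegrableOn (G.lossGrad (xbar k) (μ k)) (Metric.ball ϑ ε)) ∧
      HasGradientAt (G.smoothedLoss xbar μ ε θ₀) (G.smoothedGrad xbar μ ε ϑ) ϑ) ∧
    -- convergence
    (∀ T, MeasureTheory.Integrable
      (fun ω => ‖gradient (G.smoothedLoss xbar μ ε θ₀) (θ T ω)‖) P) ∧
    Filter.Tendsto
      (fun T => ∫ ω, ‖gradient (G.smoothedLoss xbar μ ε θ₀) (θ T ω)‖ ∂P)
      Filter.atTop (nhds 0) := by
  have hgrad : ∀ᵐ ϑ ∂(volume.restrict Θ), ∀ k,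
      HasGradientAt (G.loss (xbar k) (μ k)) (G.lossGrad (xbar k) (μ k) ϑ) ϑ := by
    filter_upwards [hWD.nondegenerate, ae_restrict_mem hΘ_open.measurableSet] with ϑ h1 h2 k
    exact InverseGame.Game.hasGradientAt_loss hG hCQ hWD hΘ_open h2 k (h1 k) (xbar k)
  set ℓ : Fin K → InverseGame.Param p → ℝ := fun k => G.loss (xbar k) (μ k) with hℓ
  set F : Fin K → InverseGame.Param p → InverseGame.Param p :=
    fun k => InverseGame.gradientOn Θ (ℓ k) with hF
  have hgradF : ∀ k, G.lossGrad (xbar k) (μ k) =ᵐ[volume.restrict Θ] F k := fun k =>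
    InverseGame.ae_eq_gradientOn hΘ_open (hgrad.mono fun ϑ h => h k)
  have hFgrad : ∀ k, ∀ᵐ x ∂volume.restrict Θ, HasGradientAt (ℓ k) (F k x) x := by
    intro k
    filter_upwards [hgrad, hgradF k] with x h1 h2
    rw [← h2]
    exact h1 k
  choose Ck hCk using fun k =>
    InverseGame.Game.exists_lipschitzOnWith_loss hG hCQ hWD hΘ_open hΘ_convex k (xbar k)
  -- The sum serves as one Lipschitz constant for all data points.
  set C : NNReal := ∑ k, Ck k
  have hlip : ∀ k, LipschitzOnWith C (ℓ k) Θ := fun k =>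
    (hCk k).weaken (Finset.single_le_sum (fun _ _ => zero_le) (Finset.mem_univ k))
  have hFm : ∀ k, Measurable (F k) := fun k => InverseGame.measurable_gradientOn hΘ_open _
  have hFC : ∀ k x, ‖F k x‖ ≤ C := fun k x => InverseGame.norm_gradientOn_le hΘ_open (hlip k) x
  set W : Set (InverseGame.Param p) := {v | Metric.closedBall v ε ⊆ Θ} with hWdef
  have hWo : IsOpen W := InverseGame.isOpen_setOf_closedBall_subset hΘ_open
  have hWc : Convex ℝ W := InverseGame.convex_setOf_closedBall_subset hΘ_convex
  set φ := InverseGame.meanLoss volume ε ℓ with hφdef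
  set g := InverseGame.meanField volume ε F with hgdef
  have hφ : ∀ v ∈ W, HasGradientAt φ (g v) v := fun v hv =>
    InverseGame.hasGradientAt_meanLoss hΘ_open hε hlip hFgrad hv
  have hgc : Continuous g := InverseGame.continuous_meanField hε C.coe_nonneg hFm hFC
  have hsg : ∀ v ∈ W, G.smoothedGrad xbar μ ε v = g v := fun v hv =>
    InverseGame.Game.smoothedGrad_eq_meanField hΘ_open hgradF hv
  -- An almost sure statement under a probability measure holds for some outcome, and every run
  -- starts at `θ₀`.
  have hθ₀ : θ₀ ∈ W := by
    obtain ⟨ω, hω⟩ := hrun.stays.exists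
    have := hω 0
    rwa [hrun.init] at this
  -- The segment from `θ₀` to `v` stays in the convex set `W`, where the averaged field has the
  -- potential `φ`; the line integral is therefore the difference of its end values.
  have hsl : ∀ v ∈ W, G.smoothedLoss xbar μ ε θ₀ v = φ v - φ θ₀ := by
    intro v hv
    rw [← InverseGame.integral_gradient_segment hWc hgc.continuousOn hφ hθ₀ hv]
    refine intervalIntegral.integral_congr fun s hs => ?_
    rw [uIcc_of_le zero_le_one] at hs
    have hmem : θ₀ + s • (v - θ₀) ∈ W := hWc.add_smul_sub_mem hθ₀ hv hs
    simp only [hsg _ hmem]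
  have hslg : ∀ v ∈ W, HasGradientAt (G.smoothedLoss xbar μ ε θ₀) (g v) v := by
    intro v hv
    have h1 : HasGradientAt (fun w => φ w - φ θ₀) (g v) v :=
      ((hφ v hv).hasFDerivAt.sub_const (φ θ₀) :)
    refine h1.congr_of_eventuallyEq ?_
    filter_upwards [hWo.mem_nhds hv] with w hw using hsl w hw
  have hsamp := hrun.isSampling
  have hiter : ∀ t, θ t =ᵐ[P] InverseGame.sampledIterate F η θ₀ κ U t :=
    hsamp.ae_eq_sampledIterate hε hFm hΘ_open hgradF hrun.init hrun.step hrun.stays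
  have hmem : ∀ᵐ ω ∂P, ∀ t, InverseGame.sampledIterate F η θ₀ κ U t ω ∈ W := by
    filter_upwards [ae_all_iff.2 hiter, hrun.stays] with ω h1 h2 t
    rw [← h1 t]
    exact h2 t
  have hnorm : ∀ t, (fun ω => ‖gradient (G.smoothedLoss xbar μ ε θ₀) (θ t ω)‖) =ᵐ[P]
      fun ω => ‖g (InverseGame.sampledIterate F η θ₀ κ U t ω)‖ := by
    intro t
    filter_upwards [hiter t, hmem] with ω h1 h2
    rw [h1, (hslg _ (h2 t)).gradient]
  have hφ0 : ∀ v ∈ W, 0 ≤ φ v := fun v _ =>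
    mul_nonneg (by positivity) (Finset.sum_nonneg fun k _ => integral_nonneg fun u =>
      Finset.sum_nonneg fun w _ => sq_nonneg _)
  refine ⟨fun ϑ hϑ k => InverseGame.Game.existsUnique_isNash hG hCQ hWD hϑ k, hgrad,
    fun ϑ hϑ => ⟨fun k => ?_, ?_⟩, fun T => ?_, ?_⟩
  · have h1 : IntegrableOn (F k) (Metric.ball ϑ ε) :=
      Measure.integrableOn_of_bounded measure_ball_lt_top.ne (hFm k).aestronglyMeasurable
        (Filter.Eventually.of_forall (hFC k))
    exact h1.congr (ae_restrict_of_ae_restrict_of_subset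
      (Metric.ball_subset_closedBall.trans hϑ) (hgradF k).symm)
  · rw [hsg ϑ hϑ]
    exact hslg ϑ hϑ
  · have h1 := hsamp.integrable_meanField (η := η) (θ₀ := θ₀) hε C.coe_nonneg hFm hFC T 1
    simp only [pow_one] at h1
    exact h1.congr (hnorm T).symm
  · exact (hsamp.tendsto_integral_norm_meanField hε C.coe_nonneg hFm hFC hη_pos hη_sum hη_sq hWc
      hφ hφ0 hmem).congr fun T => (integral_congr_ae (hnorm T)).symm
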